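/- Let $(X,d)$ be a nonempty CAT(0) space (not necessarily complete or proper), and let $g$ be an isometry of $X$. Conventions. The translation length of $g$ is $\tau(g)=\lim_{n\to\infty} d(x,g^nx)/n$ (independent of $x\in X$), and $g$ is parabolic if no $x\in X$ satisfies $d(x,gx)=\tau(g)$. A subset $A\subseteq X$ is $C$-contracting if for every open ball $B$ disjoint from $A$ the set of all points of $A$ that are closest to some point of $B$ has diameter at most $C$. The isometry $g$ is contracting if for some $x\in X$ the map $\mathbb Z\to X$, $n\mapsto g^nx$, is a quasi-isometric embedding and the orbit $\{g^nx:n\in\mathbb Z\}$ is $C$-contracting for some $C$. For $x,y\in X$, $[x,y]$ is the geodesic segment from $x$ to $y$. Let $\alpha:I\to X$ be a geodesic defined on a closed interval $I$ (bounded or unbounded), with closest point projection $\pi_\alpha:X\to I$, where we identify $\alpha(I)$ with $I$, and let $r$ be such that $[r-\frac12,r+\frac12]$ lies in the interior of $I$. The curtain dual to $\alpha$ at $r$ is $h=\pi_\alpha^{-1}([r-\frac12,r+\frac12])$, with half spaces $h^-=\pi_\alpha^{-1}((-\infty,r-\frac12))$ and $h^+=\pi_\alpha^{-1}((r+\frac12,\infty))$.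 It separates $A,B\subseteq X$ if one of them is contained in $h^-$ and the other in $h^+$. A chain is a sequence of pairwise disjoint curtains $h_i$ such that $h_i$ separates $h_{i-1}$ from $h_{i+1}$ whenever both exist. Two disjoint curtains are $L$-separated if every chain, all of whose members meet both of them, has cardinality at most $L$; an $L$-chain is a chain of pairwise $L$-separated curtains. For an integer $L\ge 1$, $X_L$ is the set $X$ with the metric given by $d_L(x,x)=0$ and, for $x\ne y$, $d_L(x,y)=1+\max\{|c| : c \text{ an } L\text{-chain each of whose members separates } \{x\} \text{ from } \{y\}\}$. Fix numbers $\lambda_L\in(0,1)$, $L\geq 1$, with $\sum_{L\ge1}\lambda_L=1$ and $\sum_{L\ge1}L^2\lambda_L<\infty$; the curtain model $X_D$ is the set $X$ with the metric $D=\sum_{L\ge1}\lambda_Ld_L$. The isometry $g$ is loxodromic on $X_L$ (resp. $X_D$) if $\lim_{n\to\infty} d_L(x,g^nx)/n>0$ (resp. $\lim_{n\to\infty}D(x,g^nx)/n>0$); again this limit exists and is independent of $x$. Theorem. If $g$ is parabolic and $\tau(g)>0$, then the following are equivalent: 1. $g$ is contracting; 2. there exist $x\in X$ and $C$ such that for every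 $n\ge0$ the segment $[x,g^nx]$ is $C$-contracting; 3. $g$ is loxodromic on $X_L$ for some integer $L\ge1$; 4. $g$ is loxodromic on $X_D$. -/

import Mathlib

open Filter Topology
open scoped ENNReal NNReal

noncomputable section

namespace CurtainModel

variable {X : Type*} [MetricSpace X]

/-- `α` restricted to `I` is a unit-speed geodesic (an isometric embedding of `I`). -/
def IsGeodesicOn (α : ℝ → X) (I : Set ℝ) : Prop :=
  ∀ s ∈ I, ∀ t ∈ I, dist (α s) (α t) = |s - t|

/-- CAT(0) spaces: geodesic metric spaces in which geodesic triangles are no fatter than their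
comparison triangles in the Euclidean plane.  Any two points on different sides of a triangle lie
on two sides `α`, `β` that issue from a common vertex; `x', y', z'` is a comparison triangle and
`p'`, `q'` are the comparison points of `α s`, `β t`. No completeness is assumed. -/
class CAT0Space (X : Type*) [MetricSpace X] : Prop where
  exists_geodesic : ∀ x y : X, ∃ γ : ℝ → X,
    IsGeodesicOn γ (Set.Icc 0 (dist x y)) ∧ γ 0 = x ∧ γ (dist x y) = y
  comparison : ∀ (a b : ℝ) (α β : ℝ → X), 0 ≤ a → 0 ≤ b →
    IsGeodesicOn α (Set.Icc 0 a) → IsGeodesicOn β (Set.Icc 0 b) → α 0 = β 0 →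
    ∀ x' y' z' : EuclideanSpace ℝ (Fin 2),
      dist x' y' = a → dist x' z' = b → dist y' z' = dist (α a) (β b) →
    ∀ s ∈ Set.Icc 0 a, ∀ t ∈ Set.Icc 0 b, ∀ p' q' : EuclideanSpace ℝ (Fin 2),
      dist x' p' = s → dist p' y' = a - s → dist x' q' = t → dist q' z' = b - t →
    dist (α s) (β t) ≤ dist p' q'

/-- The geodesic segment `[x, y]` (in a CAT(0) space the geodesic is unique). -/
def segment (x y : X) : Set X :=
  {p | ∃ γ : ℝ → X, IsGeodesicOn γ (Set.Icc 0 (dist x y)) ∧ γ 0 = x ∧ γ (dist x y) = y ∧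
    p ∈ γ '' Set.Icc 0 (dist x y)}

/-- The points of `A` closest to `p`. -/
def closestPoints (A : Set X) (p : X) : Set X :=
  {a | a ∈ A ∧ ∀ b ∈ A, dist p a ≤ dist p b}

/-- `A` is `C`-contracting: the closest point projection to `A` of every open ball disjoint from
`A` has diameter at most `C`. -/
def IsContractingSet (C : ℝ) (A : Set X) : Prop :=
  ∀ (c : X) (r : ℝ), Disjoint (Metric.ball c r) A →
    ∀ p ∈ Metric.ball c r, ∀ q ∈ Metric.ball c r,
      ∀ a ∈ closestPoints A p, ∀ b ∈ closestPoints A q, dist a b ≤ C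

/-- A map `ℤ → X` is a quasi-isometric embedding. -/
def IsQIEmbedding (f : ℤ → X) : Prop :=
  ∃ K ε : ℝ, 1 ≤ K ∧ 0 ≤ ε ∧ ∀ m n : ℤ,
    |(m : ℝ) - n| / K - ε ≤ dist (f m) (f n) ∧ dist (f m) (f n) ≤ K * |(m : ℝ) - n| + ε

/-- Contracting isometries. -/
def IsContracting (g : X ≃ᵢ X) : Prop :=
  ∃ x : X, IsQIEmbedding (fun n : ℤ => (g ^ n) x) ∧
    ∃ C : ℝ, IsContractingSet C (Set.range fun n : ℤ => (g ^ n) x)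

/-- `t` is the translation length of `g` with respect to the distance function `d`:
`d x (g ^ n x) / n → t` for every base point `x`. -/
def HasTranslationLength (d : X → X → ℝ≥0∞) (g : X ≃ᵢ X) (t : ℝ≥0) : Prop :=
  ∀ x : X, Tendsto (fun n : ℕ => d x ((g ^ n) x) / (n : ℝ≥0∞)) atTop (𝓝 (t : ℝ≥0∞))

/-- `g` is loxodromic for the distance function `d`: its translation length is positive. -/
def IsLoxodromic (d : X → X → ℝ≥0∞) (g : X ≃ᵢ X) : Prop :=
  ∃ t : ℝ≥0, 0 < t ∧ HasTranslationLength d g t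

/-- `Min(g)`: the points that `g` displaces exactly by its translation length. -/
def minSet (g : X ≃ᵢ X) : Set X :=
  {x | HasTranslationLength edist g (nndist x (g x))}

/-- Parabolic isometries of a CAT(0) space. -/
def IsParabolic (g : X ≃ᵢ X) : Prop :=
  minSet g = ∅

/-- The data of a curtain: a geodesic `α : I → X`, where `I` is a closed interval (bounded or
not, so that the closest point projection to `α` is defined), and the midpoint `r` of a pole
`[r - 1/2, r + 1/2]` in the interior of `I`. -/
structure Curtain (X : Type*) [MetricSpace X] where
  I : Set ℝ
  isClosed_I : IsClosed I
  ordConnected_I : I.OrdConnected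
  α : ℝ → X
  isGeodesicOn : IsGeodesicOn α I
  r : ℝ
  pole_subset : Set.Icc (r - 1 / 2) (r + 1 / 2) ⊆ interior I

namespace Curtain

/-- `π_α⁻¹(J)`: the points that have a closest point `α t` on `α` with `t ∈ J`. -/
def projPreimage (h : Curtain X) (J : Set ℝ) : Set X :=
  {x | ∃ t ∈ h.I, t ∈ J ∧ ∀ s ∈ h.I, dist x (h.α t) ≤ dist x (h.α s)}

/-- The curtain itself, as a subset of `X`. -/
def carrier (h : Curtain X) : Set X := h.projPreimage (Set.Icc (h.r - 1 / 2) (h.r + 1 / 2))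

/-- The half space `h⁻`. -/
def neg (h : Curtain X) : Set X := h.projPreimage (Set.Iio (h.r - 1 / 2))

/-- The half space `h⁺`. -/
def pos (h : Curtain X) : Set X := h.projPreimage (Set.Ioi (h.r + 1 / 2))

/-- `h` separates `A` from `B`. -/
def Separates (h : Curtain X) (A B : Set X) : Prop :=
  (A ⊆ h.neg ∧ B ⊆ h.pos) ∨ (B ⊆ h.neg ∧ A ⊆ h.pos)

end Curtain

/-- A (finite) chain of `n` curtains: each curtain separates its predecessor from its successor.
The curtains of a chain are disjoint; this is automatic as soon as `n ≥ 3`, and it makes the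
length `n` the cardinality of the chain. -/
def IsChain {n : ℕ} (h : Fin n → Curtain X) : Prop :=
  (∀ i j, i ≠ j → Disjoint (h i).carrier (h j).carrier) ∧
  ∀ i j k : Fin n, j.val = i.val + 1 → k.val = j.val + 1 →
    (h j).Separates (h i).carrier (h k).carrier

/-- Two disjoint curtains are `L`-separated if every chain, all of whose members meet both of
them, has cardinality at most `L`. -/
def LSeparated (L : ℕ) (h k : Curtain X) : Prop :=
  Disjoint h.carrier k.carrier ∧
  ∀ (n : ℕ) (c : Fin n → Curtain X), IsChain c →
    (∀ i, ((c i).carrier ∩ h.carrier).Nonempty ∧ ((c i).carrier ∩ k.carrier).Nonempty) → n ≤ L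

/-- `L`-chains: chains whose members are pairwise `L`-separated. -/
def IsLChain (L : ℕ) {n : ℕ} (c : Fin n → Curtain X) : Prop :=
  IsChain c ∧ ∀ i j, i ≠ j → LSeparated L (c i) (c j)

/-- There is an `L`-chain of cardinality `n` that separates `x` from `y`. -/
def ExistsLChain (L : ℕ) (x y : X) (n : ℕ) : Prop :=
  ∃ c : Fin n → Curtain X, IsLChain L c ∧ ∀ i, (c i).Separates {x} {y}

open Classical in
/-- The metric `d_L` of `X_L`: `0` on the diagonal, and otherwise one more than the largest
cardinality of an `L`-chain separating `x` from `y`. The supremum is taken in `[0, ∞]`. -/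
def distL (L : ℕ) (x y : X) : ℝ≥0∞ :=
  if x = y then 0 else 1 + ⨆ (n : ℕ) (_ : ExistsLChain L x y n), (n : ℝ≥0∞)

/-- Admissible weights `λ_L`, `L ≥ 1`, for a curtain model. -/
structure IsWeight (lam : ℕ+ → ℝ) : Prop where
  pos : ∀ L, 0 < lam L
  lt_one : ∀ L, lam L < 1
  hasSum : HasSum lam 1
  summable : Summable fun L : ℕ+ => (L : ℝ) ^ 2 * lam L

/-- The metric `D = ∑_{L ≥ 1} λ_L d_L` of the curtain model `X_D`. -/
def distD (lam : ℕ+ → ℝ) (x y : X) : ℝ≥0∞ :=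
  ∑' L : ℕ+, ENNReal.ofReal (lam L) * distL (L : ℕ) x y

end CurtainModel

end

/-!
The proof runs through the implications `1 → 2 → 3 → 1` and `3 ↔ 4`. Since `X` need not be complete,
no limits of points or of geodesics are taken; everything is deduced from the closest point
projection to a geodesic (`IsFoot`) and its Pythagorean inequality (`IsFoot.pythagoras`).

The geometric heart is a bottleneck property of `L`-separated curtains
(`exists_dist_le_of_lSeparated`): if `h₁, h₂, h₃` is an `L`-chain crossed by two geodesics, then a
point `y ∈ h₂` of the first one is at distance at most `L + 1` from the second one. Indeed, let `σ`
be the perpendicular from `y` to the second geodesic. That geodesic projects to the endpoint of `σ`,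
and one of the two halves of the first geodesic projects to `y`, so that every curtain dual to `σ`
meets `h₂` and one of `h₁`, `h₃`; there are at most `L` such curtains in a chain.

Both contracting orbits and loxodromic isometries of `X_L` give rise to a `BottleneckSystem`:
a sequence of points such that all geodesics from the left of the `k`-th point to the right of a
slightly later one pass close to it. Sets close to an interval of such a system are uniformly
contracting (`BottleneckSystem.exists_isContractingSet`).

* `1 → 2`: a geodesic that stays far away from a contracting set has bounded projection to it
  (`IsContractingSet.dist_le_of_far`), hence geodesics between points with far apart projections
  pass close to all points of the orbit in between (`exists_pass`). This makes a contracting orbit a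
  bottleneck system, and the segments `[x, g ^ n x]` are close to intervals of it.
* `2 → 3`: curtains dual to a contracting segment that are sufficiently far apart are `L`-separated
  (`exists_lSeparated_dualCurtain`), because a curtain meeting both of them contains a geodesic that
  passes through a fixed ball, and a chain of curtains meeting a ball is bounded. So `d_L` grows
  linearly along the orbit.
* `3 → 1`: comparing the lengths of `L`-chains separating points of the orbit yields a curtain `h`
  and a power `G` of `g` such that the translates of `h` by the powers of `G` form an `L`-chain
  (`IsLoxodromic.exists_below_map`). By the bottleneck property the orbit of `G` is a bottleneck
  system, so the orbit of `g` is contracting.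
* `3 ↔ 4`: by dominated convergence the translation length for `D` is the weighted sum of those for
  the metrics `d_L` (`isLoxodromic_distD_iff`).
-/

noncomputable section

namespace CurtainModel

variable {X : Type*} [MetricSpace X]

/-! ### Comparison and geodesics -/

/-- Comparison triangles `x, y, z` exist; `p` is the point at parameter `l` on the side `[x, y]`, and
its distance to `z` is given by Stewart's formula. -/
theorem exists_comparison_triangle {a b c : ℝ} (ha : 0 < a) (hb : 0 ≤ b) (hc : 0 ≤ c)
    (h₁ : c ≤ a + b) (h₂ : a ≤ b + c) (h₃ : b ≤ a + c) {l : ℝ} (hl₀ : 0 ≤ l) (hl₁ : l ≤ 1) :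
    ∃ x y z p : EuclideanSpace ℝ (Fin 2), dist x y = a ∧ dist x z = b ∧ dist y z = c ∧
      dist x p = l * a ∧ dist p y = a - l * a ∧
      dist p z ^ 2 = (1 - l) * b ^ 2 + l * c ^ 2 - l * (1 - l) * a ^ 2 := by
  set u : ℝ := (a ^ 2 + b ^ 2 - c ^ 2) / (2 * a) with hu
  have hua : 2 * a * u = a ^ 2 + b ^ 2 - c ^ 2 := by rw [hu]; field_simp
  have huv : 0 ≤ b ^ 2 - u ^ 2 := by
    have hub : u ≤ b := by
      rw [hu, div_le_iff₀ (by positivity)]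
      nlinarith [mul_nonneg (sub_nonneg.2 h₂) (sub_nonneg.2 h₃)]
    have hub' : -b ≤ u := by
      rw [hu, le_div_iff₀ (by positivity)]
      nlinarith [mul_nonneg (sub_nonneg.2 h₁) (by linarith : (0 : ℝ) ≤ a + b + c)]
    nlinarith [mul_nonneg (sub_nonneg.2 hub) (by linarith : (0 : ℝ) ≤ u + b)]
  have hv := Real.sq_sqrt huv
  set v : ℝ := √(b ^ 2 - u ^ 2)
  have key : ∀ (s t s' t' d : ℝ), 0 ≤ d → (s - s') ^ 2 + (t - t') ^ 2 = d ^ 2 →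
      dist (!₂[s, t] : EuclideanSpace ℝ (Fin 2)) !₂[s', t'] = d := by
    intro s t s' t' d hd h
    rw [EuclideanSpace.dist_eq, Fin.sum_univ_two, Real.dist_eq, Real.dist_eq, sq_abs, sq_abs]
    simp only [Matrix.cons_val_zero, Matrix.cons_val_one]
    rw [h, Real.sqrt_sq hd]
  refine ⟨!₂[0, 0], !₂[a, 0], !₂[u, v], !₂[l * a, 0], key _ _ _ _ _ ha.le (by ring),
    key _ _ _ _ _ hb (by linear_combination hv), key _ _ _ _ _ hc (by linear_combination hv - hua),
    key _ _ _ _ _ (by positivity) (by ring),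
    key _ _ _ _ _ (by nlinarith) (by ring), ?_⟩
  rw [EuclideanSpace.dist_eq, Real.sq_sqrt (by positivity), Fin.sum_univ_two, Real.dist_eq,
    Real.dist_eq, sq_abs, sq_abs]
  simp only [Matrix.cons_val_zero, Matrix.cons_val_one]
  linear_combination hv - l * hua

theorem IsGeodesicOn.mono {α : ℝ → X} {I J : Set ℝ} (h : IsGeodesicOn α I) (hJ : J ⊆ I) :
    IsGeodesicOn α J :=
  fun s hs t ht => h s (hJ hs) t (hJ ht)

theorem IsGeodesicOn.comp_add {α : ℝ → X} {I J : Set ℝ} (h : IsGeodesicOn α I) (c : ℝ)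
    (hJ : ∀ t ∈ J, c + t ∈ I) : IsGeodesicOn (fun t => α (c + t)) J := by
  intro s hs t ht
  rw [h _ (hJ s hs) _ (hJ t ht)]
  ring_nf

theorem IsGeodesicOn.continuousOn {α : ℝ → X} {I : Set ℝ} (h : IsGeodesicOn α I) :
    ContinuousOn α I := by
  have : LipschitzOnWith 1 α I := LipschitzOnWith.of_dist_le_mul fun s hs t ht => by
    rw [h s hs t ht, Real.dist_eq]; simp
  exact this.continuousOn

/-- The CAT(0) inequality for the distance from a point to a geodesic, in the form of Stewart's
formula. -/
theorem IsGeodesicOn.stewart [CAT0Space X] {α : ℝ → X} {I : Set ℝ} (h : IsGeodesicOn α I)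
    [I.OrdConnected] (p : X) {s t : ℝ} (hs : s ∈ I) (ht : t ∈ I) {l : ℝ} (hl₀ : 0 ≤ l) (hl₁ : l ≤ 1) :
    dist p (α ((1 - l) * s + l * t)) ^ 2 ≤
      (1 - l) * dist p (α s) ^ 2 + l * dist p (α t) ^ 2 - l * (1 - l) * (s - t) ^ 2 := by
  wlog hst : s ≤ t generalizing s t l with H
  · have := H ht hs (sub_nonneg.2 hl₁) (by linarith) (le_of_not_ge hst)
    rw [show (1 - (1 - l)) * t + (1 - l) * s = (1 - l) * s + l * t by ring] at this
    linarith
  rcases hst.eq_or_lt with rfl | hst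
  · rw [show (1 - l) * s + l * s = s by ring]
    apply le_of_eq; ring
  have hI : Set.Icc s t ⊆ I := Set.Icc_subset I hs ht
  have hα := h.comp_add (J := Set.Icc 0 (t - s)) s fun u hu => hI ⟨by linarith [hu.1],
    by linarith [hu.2]⟩
  obtain ⟨β, hβ, hβ₀, hβ₁⟩ := CAT0Space.exists_geodesic (α s) p
  have hst' : dist (α s) (α t) = t - s := by
    rw [h s hs t ht, abs_sub_comm, abs_of_pos (by linarith)]
  obtain ⟨x', y', z', p', hxy, hxz, hyz, hxp, hpy, hpz⟩ := exists_comparison_triangle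
    (a := t - s) (b := dist (α s) p) (c := dist (α t) p) (by linarith) dist_nonneg dist_nonneg
    (by have := dist_triangle_left (α t) p (α s); linarith)
    (by have := dist_triangle_right (α s) (α t) p; linarith)
    (by have := dist_triangle (α s) (α t) p; linarith) hl₀ hl₁
  have := CAT0Space.comparison (t - s) (dist (α s) p) (fun u => α (s + u)) β (by linarith)
    dist_nonneg hα hβ (by simp [hβ₀]) x' y' z' hxy hxz (by simp [hyz, hβ₁]) (l * (t - s))
    ⟨by nlinarith, by nlinarith⟩ (dist (α s) p) ⟨dist_nonneg, le_rfl⟩ p' z' hxp hpy hxz (by simp)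
  rw [hβ₁, show s + l * (t - s) = (1 - l) * s + l * t by ring] at this
  have h2 := pow_le_pow_left₀ dist_nonneg this 2
  rw [hpz] at h2
  rw [dist_comm p, dist_comm p, dist_comm p]
  linarith [h2]

/-- The quadrilateral inequality of CAT(0) spaces. -/
theorem dist_sq_add_dist_sq_le [CAT0Space X] (x₁ x₂ x₃ x₄ : X) :
    dist x₁ x₃ ^ 2 + dist x₂ x₄ ^ 2 ≤
      dist x₁ x₂ ^ 2 + dist x₂ x₃ ^ 2 + dist x₃ x₄ ^ 2 + dist x₁ x₄ ^ 2 := by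
  obtain ⟨γ, hγ, h₀, h₁⟩ := CAT0Space.exists_geodesic x₁ x₃
  have hm : ∀ p, _ := fun p => hγ.stewart p (s := 0) (t := dist x₁ x₃) ⟨le_rfl, dist_nonneg⟩
    ⟨dist_nonneg, le_rfl⟩ (l := 1 / 2) (by norm_num) (by norm_num)
  set m := γ ((1 - 1 / 2) * 0 + 1 / 2 * dist x₁ x₃)
  have e₂ := hm x₂
  have e₄ := hm x₄
  rw [h₀, h₁] at e₂ e₄
  have := dist_triangle x₂ m x₄
  have h5 : dist x₂ x₄ ^ 2 ≤ 2 * dist x₂ m ^ 2 + 2 * dist x₄ m ^ 2 := by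
    rw [dist_comm m x₄] at this
    nlinarith [sq_nonneg (dist x₂ m - dist x₄ m), dist_nonneg (x := x₂) (y := x₄)]
  rw [dist_comm x₂ x₁, dist_comm x₄ x₁, dist_comm x₄ x₃] at *
  nlinarith

/-! ### Closest point projection to a geodesic -/

/-- `t` is the parameter of a closest point to `p` on the geodesic `α : I → X`. -/
def IsFoot (α : ℝ → X) (I : Set ℝ) (p : X) (t : ℝ) : Prop :=
  t ∈ I ∧ ∀ s ∈ I, dist p (α t) ≤ dist p (α s)

theorem IsGeodesicOn.exists_isFoot {α : ℝ → X} {I : Set ℝ} (h : IsGeodesicOn α I)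
    (hI : IsClosed I) (hne : I.Nonempty) (p : X) : ∃ t, IsFoot α I p t := by
  obtain ⟨t₀, ht₀⟩ := hne
  set ρ := dist p (α t₀)
  have hcomp : IsCompact (Set.Icc (t₀ - 2 * ρ) (t₀ + 2 * ρ) ∩ I) := isCompact_Icc.inter_right hI
  have hρ : 0 ≤ ρ := dist_nonneg
  have ht₀' : t₀ ∈ Set.Icc (t₀ - 2 * ρ) (t₀ + 2 * ρ) ∩ I := ⟨⟨by linarith, by linarith⟩, ht₀⟩
  obtain ⟨t, ht, hmin⟩ := hcomp.exists_isMinOn ⟨t₀, ht₀'⟩ (f := fun t => dist p (α t))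
    (Continuous.comp_continuousOn (continuous_const.dist continuous_id)
      (h.continuousOn.mono Set.inter_subset_right))
  refine ⟨t, ht.2, fun s hs => ?_⟩
  by_cases hs' : s ∈ Set.Icc (t₀ - 2 * ρ) (t₀ + 2 * ρ)
  · exact hmin ⟨hs', hs⟩
  · have h1 : dist p (α t) ≤ ρ := hmin ht₀'
    have h2 := dist_triangle_left (α t₀) (α s) p
    rw [h _ ht₀ _ hs] at h2
    have h3 : 2 * ρ < |t₀ - s| := by
      by_contra hc
      push Not at hc
      rw [abs_le] at hc
      exact hs' ⟨by linarith, by linarith⟩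
    change |t₀ - s| ≤ ρ + _ at h2
    linarith

/-- The angle at the foot of a perpendicular is at least `π / 2`. -/
theorem IsFoot.pythagoras [CAT0Space X] {α : ℝ → X} {I : Set ℝ} (h : IsGeodesicOn α I) [I.OrdConnected]
    {p : X} {t : ℝ} (ht : IsFoot α I p t) {s : ℝ} (hs : s ∈ I) :
    dist p (α t) ^ 2 + (t - s) ^ 2 ≤ dist p (α s) ^ 2 := by
  have key : ∀ l : ℝ, l ∈ Set.Ioo (0 : ℝ) 1 →
      dist p (α t) ^ 2 + (1 - l) * (t - s) ^ 2 ≤ dist p (α s) ^ 2 := by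
    rintro l ⟨hl₀, hl₁⟩
    have h1 := h.stewart p ht.1 hs hl₀.le hl₁.le
    have hmem : (1 - l) * t + l * s ∈ I := by
      have := (convex_iff_ordConnected.2 ‹I.OrdConnected›) ht.1 hs (sub_nonneg.2 hl₁.le) hl₀.le
        (by ring)
      simpa using this
    have h2 := pow_le_pow_left₀ dist_nonneg (ht.2 _ hmem) 2
    have h3 : l * (dist p (α t) ^ 2 + (1 - l) * (t - s) ^ 2) ≤ l * dist p (α s) ^ 2 := by
      linarith
    exact le_of_mul_le_mul_left h3 hl₀
  have hlim : Tendsto (fun l : ℝ => dist p (α t) ^ 2 + (1 - l) * (t - s) ^ 2) (𝓝[>] 0)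
      (𝓝 (dist p (α t) ^ 2 + (1 - 0) * (t - s) ^ 2)) := by
    apply Tendsto.mono_left _ nhdsWithin_le_nhds
    exact Continuous.tendsto (by fun_prop) 0
  rw [sub_zero, one_mul] at hlim
  refine le_of_tendsto hlim ?_
  filter_upwards [Ioo_mem_nhdsGT (zero_lt_one' ℝ)] with l hl using key l hl

/-- The projection to a geodesic is 1-Lipschitz: the quadrilateral inequality for two points and
their feet, combined with the Pythagorean inequality at both feet. -/
theorem IsFoot.dist_le [CAT0Space X] {α : ℝ → X} {I : Set ℝ} (h : IsGeodesicOn α I) [I.OrdConnected]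
    {p q : X} {s t : ℝ} (hs : IsFoot α I p s) (ht : IsFoot α I q t) : |s - t| ≤ dist p q := by
  have h1 := hs.pythagoras h ht.1
  have h2 := ht.pythagoras h hs.1
  have h3 := dist_sq_add_dist_sq_le p (α s) (α t) q
  rw [h _ hs.1 _ ht.1, sq_abs, dist_comm (α s) q, dist_comm (α t) q] at h3
  apply abs_le_of_sq_le_sq _ dist_nonneg
  nlinarith

theorem IsFoot.unique [CAT0Space X] {α : ℝ → X} {I : Set ℝ} (h : IsGeodesicOn α I) [I.OrdConnected]
    {p : X} {s t : ℝ} (hs : IsFoot α I p s) (ht : IsFoot α I p t) : s = t := by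
  have := hs.dist_le h ht
  rw [dist_self] at this
  exact sub_eq_zero.1 (abs_nonpos_iff.1 this)

/-- The foot of `p` is also the foot of every point on a geodesic from `p` to it. -/
theorem IsFoot.of_between {α : ℝ → X} {I : Set ℝ} {p y : X} {t : ℝ} (ht : IsFoot α I p t)
    (hy : dist p y + dist y (α t) = dist p (α t)) : IsFoot α I y t :=
  ⟨ht.1, fun s hs => by have := ht.2 s hs; have := dist_triangle p y (α s); linarith⟩

theorem isFoot_self {α : ℝ → X} {I : Set ℝ} {t : ℝ}
    (ht : t ∈ I) : IsFoot α I (α t) t :=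
  ⟨ht, fun s _ => by rw [dist_self]; exact dist_nonneg⟩

theorem IsGeodesicOn.between {γ : ℝ → X} {a b t : ℝ} (h : IsGeodesicOn γ (Set.Icc a b))
    (ht : t ∈ Set.Icc a b) : dist (γ a) (γ t) + dist (γ t) (γ b) = dist (γ a) (γ b) := by
  have hab := ht.1.trans ht.2
  rw [h _ ⟨le_rfl, hab⟩ _ ht, h _ ht _ ⟨hab, le_rfl⟩, h _ ⟨le_rfl, hab⟩ _ ⟨hab, le_rfl⟩,
    abs_sub_comm, abs_of_nonneg (by linarith [ht.1]), abs_sub_comm, abs_of_nonneg (by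
    linarith [ht.2]), abs_sub_comm, abs_of_nonneg (by linarith)]
  ring

/-- Geodesics are unique: every point that lies metrically between `x` and `y` lies on every
geodesic from `x` to `y`. -/
theorem IsGeodesicOn.eq_of_between [CAT0Space X] {x y p : X} {γ : ℝ → X}
    (hγ : IsGeodesicOn γ (Set.Icc 0 (dist x y))) (h₀ : γ 0 = x) (h₁ : γ (dist x y) = y)
    (hp : dist x p + dist p y = dist x y) : γ (dist x p) = p := by
  have hle : dist x p ≤ dist x y := by have := dist_nonneg (x := p) (y := y); linarith
  rcases (dist_nonneg (x := x) (y := y)).eq_or_lt with h | h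
  · have hxp : dist x p = 0 := le_antisymm (hle.trans h.ge) dist_nonneg
    rw [hxp, h₀, dist_eq_zero.1 hxp]
  · have h2 := hγ.stewart p ⟨le_rfl, h.le⟩ ⟨h.le, le_rfl⟩ (l := dist x p / dist x y)
      (by positivity) (by rwa [div_le_one h])
    rw [h₀, h₁, show (1 - dist x p / dist x y) * 0 + dist x p / dist x y * dist x y = dist x p by
      field_simp; ring, dist_comm p x, show dist p y = dist x y - dist x p by linarith] at h2
    have h3 : (1 - dist x p / dist x y) * dist x p ^ 2 +
        dist x p / dist x y * (dist x y - dist x p) ^ 2 -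
        dist x p / dist x y * (1 - dist x p / dist x y) * (0 - dist x y) ^ 2 = 0 := by
      field_simp; ring
    rw [h3] at h2
    exact (dist_eq_zero.1 (pow_eq_zero_iff two_ne_zero |>.1 (le_antisymm h2 (by positivity)))).symm

theorem mem_segment_iff [CAT0Space X] {x y p : X} :
    p ∈ segment x y ↔ dist x p + dist p y = dist x y := by
  constructor
  · rintro ⟨γ, hγ, h₀, h₁, t, ht, rfl⟩
    have := hγ.between ht
    rwa [h₀, h₁] at this
  · intro hp
    obtain ⟨γ, hγ, h₀, h₁⟩ := CAT0Space.exists_geodesic x y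
    exact ⟨γ, hγ, h₀, h₁, _, ⟨dist_nonneg, by
      have := dist_nonneg (x := p) (y := y); linarith⟩, hγ.eq_of_between h₀ h₁ hp⟩

theorem segment_eq_image [CAT0Space X] {x y : X} {γ : ℝ → X}
    (hγ : IsGeodesicOn γ (Set.Icc 0 (dist x y))) (h₀ : γ 0 = x) (h₁ : γ (dist x y) = y) :
    segment x y = γ '' Set.Icc 0 (dist x y) := by
  ext p
  constructor
  · intro hp
    rw [mem_segment_iff] at hp
    exact ⟨_, ⟨dist_nonneg, by have := dist_nonneg (x := p) (y := y); linarith⟩,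
      hγ.eq_of_between h₀ h₁ hp⟩
  · exact fun hp => ⟨γ, hγ, h₀, h₁, hp⟩

/-! ### Curtains and their half spaces -/

namespace Curtain

instance ordConnected (h : Curtain X) : h.I.OrdConnected := h.ordConnected_I

theorem Icc_pole_subset (h : Curtain X) : Set.Icc (h.r - 1 / 2) (h.r + 1 / 2) ⊆ h.I :=
  h.pole_subset.trans interior_subset

theorem r_mem (h : Curtain X) : h.r ∈ h.I :=
  h.Icc_pole_subset ⟨by linarith, by linarith⟩

theorem exists_isFoot (h : Curtain X) (p : X) : ∃ t, IsFoot h.α h.I p t :=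
  h.isGeodesicOn.exists_isFoot h.isClosed_I ⟨h.r, h.r_mem⟩ p

/-- The closest point projection `π_α : X → I` to the geodesic that carries the curtain. -/
def proj (h : Curtain X) (p : X) : ℝ := (h.exists_isFoot p).choose

theorem isFoot_proj (h : Curtain X) (p : X) : IsFoot h.α h.I p (h.proj p) :=
  (h.exists_isFoot p).choose_spec

section

variable [CAT0Space X]

theorem proj_eq (h : Curtain X) {p : X} {t : ℝ} (ht : IsFoot h.α h.I p t) : h.proj p = t :=
  (h.isFoot_proj p).unique h.isGeodesicOn ht

theorem abs_proj_sub_le (h : Curtain X) (p q : X) : |h.proj p - h.proj q| ≤ dist p q :=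
  (h.isFoot_proj p).dist_le h.isGeodesicOn (h.isFoot_proj q)

theorem continuous_proj (h : Curtain X) : Continuous h.proj := by
  have : LipschitzWith 1 h.proj := LipschitzWith.of_dist_le_mul fun p q => by
    rw [Real.dist_eq]; simpa using h.abs_proj_sub_le p q
  exact this.continuous

theorem mem_projPreimage (h : Curtain X) {J : Set ℝ} {p : X} :
    p ∈ h.projPreimage J ↔ h.proj p ∈ J := by
  constructor
  · rintro ⟨t, ht, htJ, hmin⟩
    rwa [h.proj_eq ⟨ht, hmin⟩]
  · intro hp
    exact ⟨_, (h.isFoot_proj p).1, hp, (h.isFoot_proj p).2⟩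

theorem mem_neg (h : Curtain X) {p : X} : p ∈ h.neg ↔ h.proj p < h.r - 1 / 2 :=
  h.mem_projPreimage

theorem mem_pos (h : Curtain X) {p : X} : p ∈ h.pos ↔ h.r + 1 / 2 < h.proj p :=
  h.mem_projPreimage

theorem mem_carrier (h : Curtain X) {p : X} :
    p ∈ h.carrier ↔ h.r - 1 / 2 ≤ h.proj p ∧ h.proj p ≤ h.r + 1 / 2 :=
  h.mem_projPreimage

theorem proj_eq_of_between (h : Curtain X) {p y : X}
    (hy : dist p y + dist y (h.α (h.proj p)) = dist p (h.α (h.proj p))) :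
    h.proj y = h.proj p :=
  h.proj_eq ((h.isFoot_proj p).of_between hy)

theorem proj_α (h : Curtain X) {t : ℝ} (ht : t ∈ h.I) : h.proj (h.α t) = t :=
  h.proj_eq (isFoot_self ht)

/-- Preimages of intervals are connected, because the projection is constant along the geodesic
from a point to its foot. -/
theorem isPreconnected_projPreimage (h : Curtain X) {J : Set ℝ} (hJ : J.OrdConnected) :
    IsPreconnected (h.projPreimage J) := by
  rcases (h.projPreimage J).eq_empty_or_nonempty with he | ⟨q, hq⟩
  · rw [he]; exact isPreconnected_empty
  rw [mem_projPreimage] at hq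
  have hα : IsPreconnected (h.α '' (h.I ∩ J)) :=
    (Set.OrdConnected.inter h.ordConnected_I hJ).isPreconnected.image _
      (h.isGeodesicOn.continuousOn.mono Set.inter_subset_left)
  refine isPreconnected_of_forall (h.α (h.proj q)) fun p hp => ?_
  rw [mem_projPreimage] at hp
  obtain ⟨γ, hγ, h₀, h₁⟩ := CAT0Space.exists_geodesic p (h.α (h.proj p))
  have hd : (0 : ℝ) ≤ dist p (h.α (h.proj p)) := dist_nonneg
  refine ⟨h.α '' (h.I ∩ J) ∪ γ '' Set.Icc 0 (dist p (h.α (h.proj p))), ?_,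
    Or.inl ⟨_, ⟨(h.isFoot_proj q).1, hq⟩, rfl⟩, Or.inr ⟨0, ⟨le_rfl, hd⟩, h₀⟩, ?_⟩
  · rintro _ (⟨t, ht, rfl⟩ | ⟨t, ht, rfl⟩)
    · rw [mem_projPreimage, h.proj_α ht.1]; exact ht.2
    · have := hγ.between ht
      rw [h₀, h₁] at this
      rw [mem_projPreimage, h.proj_eq_of_between this]; exact hp
  · exact hα.union (h.α (h.proj p)) ⟨_, ⟨(h.isFoot_proj p).1, hp⟩, rfl⟩ ⟨_, ⟨hd, le_rfl⟩, h₁⟩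
      (isPreconnected_Icc.image _ hγ.continuousOn)

theorem isPreconnected_carrier (h : Curtain X) : IsPreconnected h.carrier :=
  h.isPreconnected_projPreimage Set.ordConnected_Icc

theorem carrier_nonempty (h : Curtain X) : h.carrier.Nonempty :=
  ⟨h.α h.r, h.mem_carrier.2 (by rw [h.proj_α h.r_mem]; constructor <;> linarith)⟩

theorem carrier_union_neg (h : Curtain X) :
    h.carrier ∪ h.neg = h.projPreimage (Set.Iic (h.r + 1 / 2)) := by
  ext p
  rw [Set.mem_union, mem_carrier, mem_neg, mem_projPreimage, Set.mem_Iic]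
  constructor
  · rintro (h | h) <;> linarith
  · intro hp
    rcases lt_or_ge (h.proj p) (h.r - 1 / 2) with h' | h'
    exacts [Or.inr h', Or.inl ⟨h', hp⟩]

theorem carrier_union_pos (h : Curtain X) :
    h.carrier ∪ h.pos = h.projPreimage (Set.Ici (h.r - 1 / 2)) := by
  ext p
  rw [Set.mem_union, mem_carrier, mem_pos, mem_projPreimage, Set.mem_Ici]
  constructor
  · rintro (h | h) <;> linarith
  · intro hp
    rcases lt_or_ge (h.r + 1 / 2) (h.proj p) with h' | h'
    exacts [Or.inr h', Or.inl ⟨hp, h'⟩]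

theorem isPreconnected_carrier_union_neg (h : Curtain X) : IsPreconnected (h.carrier ∪ h.neg) := by
  rw [carrier_union_neg]; exact h.isPreconnected_projPreimage Set.ordConnected_Iic

theorem isPreconnected_carrier_union_pos (h : Curtain X) : IsPreconnected (h.carrier ∪ h.pos) := by
  rw [carrier_union_pos]; exact h.isPreconnected_projPreimage Set.ordConnected_Ici

theorem mem_carrier_of_not_mem (h : Curtain X) {p : X} (hn : p ∉ h.neg) (hp : p ∉ h.pos) :
    p ∈ h.carrier := by
  rw [mem_neg, not_lt] at hn
  rw [mem_pos, not_lt] at hp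
  exact h.mem_carrier.2 ⟨hn, hp⟩

theorem disjoint_neg_pos (h : Curtain X) : Disjoint h.neg h.pos := by
  rw [Set.disjoint_left]
  intro p hp hp'
  rw [mem_neg] at hp
  rw [mem_pos] at hp'
  linarith

theorem disjoint_carrier_neg (h : Curtain X) : Disjoint h.carrier h.neg := by
  rw [Set.disjoint_left]
  intro p hp hp'
  rw [mem_carrier] at hp
  rw [mem_neg] at hp'
  linarith

theorem disjoint_carrier_pos (h : Curtain X) : Disjoint h.carrier h.pos := by
  rw [Set.disjoint_left]
  intro p hp hp'
  rw [mem_carrier] at hp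
  rw [mem_pos] at hp'
  linarith

/-- A connected set that misses a curtain lies in one of its half spaces. -/
theorem subset_neg_or_subset_pos (h : Curtain X) {S : Set X} (hS : IsPreconnected S)
    (hd : Disjoint S h.carrier) : S ⊆ h.neg ∨ S ⊆ h.pos := by
  have hn : IsOpen h.neg := by
    have : h.neg = h.proj ⁻¹' Set.Iio (h.r - 1 / 2) := by ext p; exact h.mem_neg
    rw [this]; exact isOpen_Iio.preimage h.continuous_proj
  have hp : IsOpen h.pos := by
    have : h.pos = h.proj ⁻¹' Set.Ioi (h.r + 1 / 2) := by ext p; exact h.mem_pos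
    rw [this]; exact isOpen_Ioi.preimage h.continuous_proj
  refine hS.subset_or_subset hn hp h.disjoint_neg_pos fun p hpS => ?_
  by_contra hc
  rw [Set.mem_union, not_or] at hc
  exact Set.disjoint_left.1 hd hpS (h.mem_carrier_of_not_mem hc.1 hc.2)

theorem subset_neg_of_mem (h : Curtain X) {S : Set X} (hS : IsPreconnected S)
    (hd : Disjoint S h.carrier) {p : X} (hpS : p ∈ S) (hp : p ∈ h.neg) : S ⊆ h.neg :=
  (h.subset_neg_or_subset_pos hS hd).resolve_right fun hc =>
    Set.disjoint_left.1 h.disjoint_neg_pos hp (hc hpS)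

theorem subset_pos_of_mem (h : Curtain X) {S : Set X} (hS : IsPreconnected S)
    (hd : Disjoint S h.carrier) {p : X} (hpS : p ∈ S) (hp : p ∈ h.pos) : S ⊆ h.pos :=
  (h.subset_neg_or_subset_pos hS hd).resolve_left fun hc =>
    Set.disjoint_left.1 h.disjoint_neg_pos (hc hpS) hp

/-- A connected set with points on both sides of a curtain meets it. -/
theorem inter_carrier_nonempty (h : Curtain X) {S : Set X} (hS : IsPreconnected S) {p q : X}
    (hpS : p ∈ S) (hqS : q ∈ S) (hp : p ∈ h.neg) (hq : q ∈ h.pos) :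
    (h.carrier ∩ S).Nonempty := by
  by_contra hc
  rw [Set.not_nonempty_iff_eq_empty, ← Set.disjoint_iff_inter_eq_empty] at hc
  exact Set.disjoint_left.1 h.disjoint_neg_pos (h.subset_neg_of_mem hS hc.symm hpS hp hqS) hq

/-- A geodesic that crosses a curtain enters it at the near end of the pole. -/
theorem exists_between_proj_eq (h : Curtain X) {u v : X} (hu : u ∈ h.neg) (hv : v ∈ h.pos) :
    ∃ w, dist u w + dist w v = dist u v ∧ h.proj w = h.r - 1 / 2 := by
  obtain ⟨γ, hγ, h₀, h₁⟩ := CAT0Space.exists_geodesic u v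
  rw [mem_neg] at hu
  rw [mem_pos] at hv
  have := intermediate_value_Icc (dist_nonneg (x := u) (y := v))
    (h.continuous_proj.comp_continuousOn hγ.continuousOn)
  simp only [Function.comp_apply, h₀, h₁] at this
  obtain ⟨t, ht, hte⟩ := this (a := h.r - 1 / 2) ⟨hu.le, by linarith⟩
  have hb := hγ.between ht
  rw [h₀, h₁] at hb
  exact ⟨γ t, hb, hte⟩

theorem exists_between_mem_carrier (h : Curtain X) {u v : X} (hu : u ∈ h.neg) (hv : v ∈ h.pos) :
    ∃ w ∈ h.carrier, dist u w + dist w v = dist u v := by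
  obtain ⟨w, hw, he⟩ := h.exists_between_proj_eq hu hv
  exact ⟨w, h.mem_carrier.2 (by rw [he]; constructor <;> linarith), hw⟩

end

/-- The curtain with its geodesic traversed backwards. -/
def flip (h : Curtain X) : Curtain X where
  I := (fun t => -t) ⁻¹' h.I
  isClosed_I := h.isClosed_I.preimage continuous_neg
  ordConnected_I := h.ordConnected_I.preimage_anti fun _ _ => neg_le_neg
  α t := h.α (-t)
  isGeodesicOn s hs t ht := by
    rw [h.isGeodesicOn _ hs _ ht, abs_sub_comm]; ring_nf
  r := -h.r
  pole_subset := by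
    refine Set.Subset.trans (fun t ht => ?_)
      (preimage_interior_subset_interior_preimage continuous_neg)
    exact h.pole_subset ⟨by linarith [ht.2], by linarith [ht.1]⟩

theorem flip_projPreimage (h : Curtain X) (J : Set ℝ) :
    h.flip.projPreimage J = h.projPreimage ((fun t => -t) ⁻¹' J) := by
  ext p
  constructor
  · rintro ⟨t, ht, hJ, hm⟩
    exact ⟨-t, ht, by simpa using hJ, fun s hs => by
      simpa [flip] using hm (-s) (by simpa [flip] using hs)⟩
  · rintro ⟨t, ht, hJ, hm⟩
    exact ⟨-t, by simpa [flip] using ht, hJ, fun s hs => by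
      simpa [flip] using hm (-s) (by simpa [flip] using hs)⟩

theorem flip_carrier (h : Curtain X) : h.flip.carrier = h.carrier := by
  rw [carrier, flip_projPreimage, carrier]
  congr 1
  ext t
  simp only [flip, Set.mem_preimage, Set.mem_Icc]
  constructor <;> rintro ⟨h1, h2⟩ <;> constructor <;> linarith

theorem flip_neg (h : Curtain X) : h.flip.neg = h.pos := by
  rw [neg, flip_projPreimage, pos]
  congr 1
  ext t
  simp only [flip, Set.mem_preimage, Set.mem_Iio, Set.mem_Ioi]
  constructor <;> intro _ <;> linarith

theorem flip_pos (h : Curtain X) : h.flip.pos = h.neg := by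
  rw [pos, flip_projPreimage, neg]
  congr 1
  ext t
  simp only [flip, Set.mem_preimage, Set.mem_Iio, Set.mem_Ioi]
  constructor <;> intro _ <;> linarith

/-- The image of a curtain under an isometry. -/
def map (g : X ≃ᵢ X) (h : Curtain X) : Curtain X where
  I := h.I
  isClosed_I := h.isClosed_I
  ordConnected_I := h.ordConnected_I
  α t := g (h.α t)
  isGeodesicOn s hs t ht := by rw [g.dist_eq, h.isGeodesicOn s hs t ht]
  r := h.r
  pole_subset := h.pole_subset

theorem map_projPreimage (g : X ≃ᵢ X) (h : Curtain X) (J : Set ℝ) :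
    (h.map g).projPreimage J = g '' h.projPreimage J := by
  ext p
  obtain ⟨p, rfl⟩ := g.surjective p
  rw [g.injective.mem_set_image]
  simp only [projPreimage, map, g.dist_eq, Set.mem_ofPred_eq]

theorem map_map (g g' : X ≃ᵢ X) (h : Curtain X) : (h.map g).map g' = h.map (g' * g) := rfl

theorem map_carrier (g : X ≃ᵢ X) (h : Curtain X) : (h.map g).carrier = g '' h.carrier :=
  h.map_projPreimage g _

theorem map_neg (g : X ≃ᵢ X) (h : Curtain X) : (h.map g).neg = g '' h.neg :=
  h.map_projPreimage g _

theorem map_pos (g : X ≃ᵢ X) (h : Curtain X) : (h.map g).pos = g '' h.pos :=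
  h.map_projPreimage g _

theorem Separates.symm {h : Curtain X} {A B : Set X} (hs : h.Separates A B) : h.Separates B A :=
  Or.symm hs

theorem Separates.mono {h : Curtain X} {A B A' B' : Set X} (hs : h.Separates A B) (hA : A' ⊆ A)
    (hB : B' ⊆ B) : h.Separates A' B' :=
  hs.imp (fun hs => ⟨hA.trans hs.1, hB.trans hs.2⟩) fun hs => ⟨hB.trans hs.1, hA.trans hs.2⟩

theorem Separates.map {h : Curtain X} {A B : Set X} (hs : h.Separates A B) (g : X ≃ᵢ X) :
    (h.map g).Separates (g '' A) (g '' B) := by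
  rw [Separates, map_neg, map_pos]
  exact hs.imp (fun hs => ⟨Set.image_mono hs.1, Set.image_mono hs.2⟩)
    fun hs => ⟨Set.image_mono hs.1, Set.image_mono hs.2⟩

theorem Separates.flip {h : Curtain X} {A B : Set X} (hs : h.Separates A B) :
    h.flip.Separates A B := by
  rw [Separates, flip_neg, flip_pos]
  exact hs.symm.imp And.symm And.symm

theorem Separates.exists_orientation {h : Curtain X} {x y : X} (hs : h.Separates {x} {y}) :
    ∃ h' : Curtain X, (h'.carrier = h.carrier ∧ ∀ A B, h.Separates A B → h'.Separates A B) ∧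
      x ∈ h'.neg ∧ y ∈ h'.pos := by
  simp only [Separates, Set.singleton_subset_iff] at hs
  rcases hs with hs | hs
  · exact ⟨h, ⟨rfl, fun _ _ => id⟩, hs⟩
  · exact ⟨h.flip, ⟨h.flip_carrier, fun _ _ => Separates.flip⟩, by rw [flip_neg]; exact hs.2,
      by rw [flip_pos]; exact hs.1⟩

/-- `h` lies strictly below `k`: the curtain `h`, together with its negative half space, is
contained in the negative half space of `k`. -/
def Below (h k : Curtain X) : Prop :=
  h.carrier ∪ h.neg ⊆ k.neg

theorem Below.carrier_subset {h k : Curtain X} (hk : h.Below k) : h.carrier ⊆ k.neg :=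
  Set.subset_union_left.trans hk

theorem Below.neg_subset {h k : Curtain X} (hk : h.Below k) : h.neg ⊆ k.neg :=
  Set.subset_union_right.trans hk

theorem Below.trans {h k l : Curtain X} (hk : h.Below k) (hl : k.Below l) : h.Below l :=
  Set.Subset.trans hk hl.neg_subset

theorem Below.map {h k : Curtain X} (hk : h.Below k) (g : X ≃ᵢ X) : (h.map g).Below (k.map g) := by
  rw [Below, map_carrier, map_neg, map_neg, ← Set.image_union]
  exact Set.image_mono hk

variable [CAT0Space X]

/-- Separation propagates along a chain. -/
theorem Separates.trans {h k : Curtain X} {A B : Set X} (h₁ : h.Separates A k.carrier)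
    (h₂ : k.Separates h.carrier B) : k.Separates A B := by
  have key : ∀ S : Set X, IsPreconnected (h.carrier ∪ S) → Disjoint S k.carrier → A ⊆ S →
      k.Separates A B := by
    intro S hS hd hA
    have hk : Disjoint (h.carrier ∪ S) k.carrier := by
      rw [Set.disjoint_union_left]
      refine ⟨?_, hd⟩
      rcases h₂ with h₂ | h₂
      · exact (k.disjoint_carrier_neg.mono_right h₂.1).symm
      · exact (k.disjoint_carrier_pos.mono_right h₂.2).symm
    obtain ⟨p, hp⟩ := h.carrier_nonempty
    rcases h₂ with h₂ | h₂
    · exact Or.inl ⟨(hA.trans Set.subset_union_right).trans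
        (k.subset_neg_of_mem hS hk (Or.inl hp) (h₂.1 hp)), h₂.2⟩
    · exact Or.inr ⟨h₂.1, (hA.trans Set.subset_union_right).trans
        (k.subset_pos_of_mem hS hk (Or.inl hp) (h₂.2 hp))⟩
  rcases h₁ with h₁ | h₁
  · exact key _ h.isPreconnected_carrier_union_neg (h.disjoint_neg_pos.mono_right h₁.2) h₁.1
  · exact key _ h.isPreconnected_carrier_union_pos (h.disjoint_neg_pos.symm.mono_right h₁.1) h₁.2

theorem Below.subset_pos {h k : Curtain X} (hk : h.Below k) : k.carrier ∪ k.pos ⊆ h.pos := by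
  intro p hp
  by_contra hc
  have hkn : p ∈ k.neg := by
    by_cases hn : p ∈ h.neg
    · exact hk.neg_subset hn
    · exact hk.carrier_subset (h.mem_carrier_of_not_mem hn hc)
  rcases hp with hp | hp
  · exact Set.disjoint_left.1 k.disjoint_carrier_neg hp hkn
  · exact Set.disjoint_left.1 k.disjoint_neg_pos hkn hp

theorem Below.carrier_subset_pos {h k : Curtain X} (hk : h.Below k) : k.carrier ⊆ h.pos :=
  Set.subset_union_left.trans hk.subset_pos

theorem Below.pos_subset {h k : Curtain X} (hk : h.Below k) : k.pos ⊆ h.pos :=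
  Set.subset_union_right.trans hk.subset_pos

theorem Below.disjoint {h k : Curtain X} (hk : h.Below k) : Disjoint h.carrier k.carrier :=
  (k.disjoint_carrier_neg.mono_right hk.carrier_subset).symm

theorem Below.irrefl (h : Curtain X) : ¬ h.Below h := fun hh => by
  obtain ⟨p, hp⟩ := h.carrier_nonempty
  exact Set.disjoint_left.1 hh.disjoint hp hp

/-- Disjoint curtains that separate the same two points are nested. -/
theorem below_or_below {h k : Curtain X} (hd : Disjoint h.carrier k.carrier) {x y : X}
    (hx : x ∈ h.neg) (kx : x ∈ k.neg) (hy : y ∈ h.pos) (ky : y ∈ k.pos) :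
    h.Below k ∨ k.Below h := by
  rcases h.subset_neg_or_subset_pos k.isPreconnected_carrier hd.symm with hk | hk
  · right
    have h1 : h.carrier ∪ h.pos ⊆ k.pos :=
      k.subset_pos_of_mem h.isPreconnected_carrier_union_pos
        (Set.disjoint_union_left.2 ⟨hd, h.disjoint_neg_pos.symm.mono_right hk⟩) (Or.inr hy) ky
    intro p hp
    by_contra hc
    have h2 : p ∈ k.pos := h1 (by
      by_cases hpp : p ∈ h.pos
      · exact Or.inr hpp
      · exact Or.inl (h.mem_carrier_of_not_mem hc hpp))
    rcases hp with hp | hp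
    · exact Set.disjoint_left.1 k.disjoint_carrier_pos hp h2
    · exact Set.disjoint_left.1 k.disjoint_neg_pos hp h2
  · left
    exact k.subset_neg_of_mem h.isPreconnected_carrier_union_neg
        (Set.disjoint_union_left.2 ⟨hd, h.disjoint_neg_pos.mono_right hk⟩) (Or.inr hx) kx

end Curtain

section

/-! ### Chains and separation -/

theorem LSeparated.congr {L : ℕ} {h k h' k' : Curtain X} (hs : LSeparated L h k)
    (hh : h'.carrier = h.carrier) (hk : k'.carrier = k.carrier) : LSeparated L h' k' := by
  rw [LSeparated, hh, hk]; exact hs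

theorem LSeparated.symm {L : ℕ} {h k : Curtain X} (hs : LSeparated L h k) : LSeparated L k h :=
  ⟨hs.1.symm, fun n c hc hm => hs.2 n c hc fun i => (hm i).symm⟩

theorem IsChain.map {n : ℕ} {c : Fin n → Curtain X} (hc : IsChain c) (g : X ≃ᵢ X) :
    IsChain fun i => (c i).map g := by
  refine ⟨fun i j hij => ?_, fun i j k hj hk => ?_⟩
  · rw [Curtain.map_carrier, Curtain.map_carrier, Set.disjoint_image_iff g.injective]
    exact hc.1 i j hij
  · rw [Curtain.map_carrier, Curtain.map_carrier]
    exact (hc.2 i j k hj hk).map g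

theorem Curtain.carrier_map_symm_map (h : Curtain X) (g : X ≃ᵢ X) :
    ((h.map g.symm).map g).carrier = h.carrier := by
  rw [map_carrier, map_carrier, ← Set.image_comp]
  simp

theorem LSeparated.map {L : ℕ} {h k : Curtain X} (hs : LSeparated L h k) (g : X ≃ᵢ X) :
    LSeparated L (h.map g) (k.map g) := by
  refine ⟨?_, fun n c hc hm => hs.2 n (fun i => (c i).map g.symm) (hc.map _) fun i => ?_⟩
  · rw [Curtain.map_carrier, Curtain.map_carrier, Set.disjoint_image_iff g.injective]
    exact hs.1
  · have h1 := hm i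
    rw [← (c i).carrier_map_symm_map g, Curtain.map_carrier g, Curtain.map_carrier g,
      Curtain.map_carrier g, ← Set.image_inter g.injective, ← Set.image_inter g.injective,
      Set.image_nonempty, Set.image_nonempty] at h1
    exact h1

/-- The curtain dual to a geodesic segment of length `l` at `r`. -/
def dualCurtain {γ : ℝ → X} {l : ℝ} (hγ : IsGeodesicOn γ (Set.Icc 0 l)) (r : ℝ)
    (h₀ : 1 / 2 < r) (h₁ : r + 1 / 2 < l) : Curtain X where
  I := Set.Icc 0 l
  isClosed_I := isClosed_Icc
  ordConnected_I := Set.ordConnected_Icc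
  α := γ
  isGeodesicOn := hγ
  r := r
  pole_subset := by
    rw [interior_Icc]
    exact fun t ht => ⟨by linarith [ht.1], by linarith [ht.2]⟩

variable [CAT0Space X]

theorem dualCurtain_proj_eq {γ : ℝ → X} {l : ℝ} (hγ : IsGeodesicOn γ (Set.Icc 0 l)) {r : ℝ}
    (h₀ : 1 / 2 < r) (h₁ : r + 1 / 2 < l) {p : X} {t : ℝ} (ht : IsFoot γ (Set.Icc 0 l) p t) :
    (dualCurtain hγ r h₀ h₁).proj p = t :=
  (dualCurtain hγ r h₀ h₁).proj_eq ht

theorem dualCurtain_below {γ : ℝ → X} {l : ℝ} (hγ : IsGeodesicOn γ (Set.Icc 0 l)) {r r' : ℝ}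
    (h₀ : 1 / 2 < r) (h₁ : r + 1 / 2 < l) (h₀' : 1 / 2 < r') (h₁' : r' + 1 / 2 < l)
    (hr : r + 1 < r') : (dualCurtain hγ r h₀ h₁).Below (dualCurtain hγ r' h₀' h₁') := by
  rw [Curtain.Below, Curtain.carrier_union_neg]
  intro p hp
  rw [Curtain.mem_projPreimage] at hp
  rw [Curtain.mem_neg, dualCurtain_proj_eq hγ h₀' h₁' ((dualCurtain hγ r h₀ h₁).isFoot_proj p)]
  have hp : (dualCurtain hγ r h₀ h₁).proj p ≤ r + 1 / 2 := hp
  change _ < r' - 1 / 2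
  linarith

theorem isChain_of_below {n : ℕ} {c : Fin n → Curtain X}
    (hc : ∀ i j, i < j → (c i).Below (c j)) : IsChain c := by
  refine ⟨fun i j hij => ?_, fun i j k hj hk => Or.inl ⟨?_, ?_⟩⟩
  · rcases lt_or_gt_of_ne hij with h | h
    exacts [(hc i j h).disjoint, (hc j i h).disjoint.symm]
  · exact (hc i j (Fin.lt_def.2 (by omega))).carrier_subset
  · exact (hc j k (Fin.lt_def.2 (by omega))).carrier_subset_pos

/-- A connected set that meets `h` and `k` also meets every curtain between them. -/
theorem LSeparated.of_below_right {L : ℕ} {h e k : Curtain X} (hs : LSeparated L h e)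
    (he : h.Below e) (ek : e.Below k) : LSeparated L h k := by
  refine ⟨(he.trans ek).disjoint, fun n c hc hm => hs.2 n c hc fun i => ⟨(hm i).1, ?_⟩⟩
  obtain ⟨⟨p, hp, hp'⟩, ⟨q, hq, hq'⟩⟩ := hm i
  obtain ⟨w, hw, hw'⟩ := e.inter_carrier_nonempty (c i).isPreconnected_carrier hp hq
    (he.carrier_subset hp') (ek.carrier_subset_pos hq')
  exact ⟨w, hw', hw⟩

/-- A finite family of disjoint curtains that separate `x` from `y` can be listed, and oriented,
in the order in which a path from `x` to `y` crosses them. -/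
theorem exists_sorted {ι : Type*} (s : Finset ι) (c : ι → Curtain X)
    (hd : ∀ i ∈ s, ∀ j ∈ s, i ≠ j → Disjoint (c i).carrier (c j).carrier) {x y : X}
    (hs : ∀ i ∈ s, (c i).Separates {x} {y}) :
    ∃ (e : Fin s.card → ι) (c' : Fin s.card → Curtain X), Function.Injective e ∧
      (∀ k, e k ∈ s ∧ ((c' k).carrier = (c (e k)).carrier ∧
        ∀ A B, (c (e k)).Separates A B → (c' k).Separates A B) ∧
        x ∈ (c' k).neg ∧ y ∈ (c' k).pos) ∧
      ∀ k l, k < l → (c' k).Below (c' l) := by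
  classical
  have ho : ∀ i, ∃ h : Curtain X, i ∈ s →
      (h.carrier = (c i).carrier ∧ ∀ A B, (c i).Separates A B → h.Separates A B) ∧
        x ∈ h.neg ∧ y ∈ h.pos := by
    intro i
    by_cases hi : i ∈ s
    · obtain ⟨h, hh⟩ := (hs i hi).exists_orientation
      exact ⟨h, fun _ => hh⟩
    · exact ⟨c i, fun hc => absurd hc hi⟩
  choose o ho using ho
  -- The position of a curtain is the number of members of the family that lie below it.
  set f : ι → ℕ := fun i => (s.filter fun j => (o j).Below (o i)).card with hf
  have hmono : ∀ i ∈ s, ∀ j ∈ s, (o i).Below (o j) → f i < f j := by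
    intro i hi j hj hij
    apply Finset.card_lt_card
    rw [Finset.ssubset_iff_of_subset]
    · exact ⟨i, by simp [hi, hij], by simp [Curtain.Below.irrefl]⟩
    · intro a ha
      rw [Finset.mem_filter] at ha ⊢
      exact ⟨ha.1, ha.2.trans hij⟩
  have htri : ∀ i ∈ s, ∀ j ∈ s, i ≠ j → (o i).Below (o j) ∨ (o j).Below (o i) := by
    intro i hi j hj hij
    obtain ⟨i1, i2, i3⟩ := ho i hi
    obtain ⟨j1, j2, j3⟩ := ho j hj
    exact Curtain.below_or_below (by rw [i1.1, j1.1]; exact hd i hi j hj hij) i2 j2 i3 j3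
  have hinj : Set.InjOn f s := by
    intro i hi j hj hij
    by_contra hne
    rcases htri i hi j hj hne with h | h
    · exact absurd hij (hmono i hi j hj h).ne
    · exact absurd hij (hmono j hj i hi h).ne'
  have hcard : (s.image f).card = s.card := Finset.card_image_of_injOn hinj
  have hex : ∀ k : Fin s.card, ∃ i ∈ s, f i = (s.image f).orderEmbOfFin hcard k := fun k =>
    Finset.mem_image.1 (Finset.orderEmbOfFin_mem _ hcard k)
  choose e he hfe using hex
  have hlt : ∀ k l, k < l → f (e k) < f (e l) := fun k l hkl => by
    rw [hfe, hfe]; exact ((s.image f).orderEmbOfFin hcard).strictMono hkl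
  refine ⟨e, fun k => o (e k), fun k l hkl => ?_, fun k => ⟨he k, ho _ (he k)⟩, fun k l hkl => ?_⟩
  · apply ((s.image f).orderEmbOfFin hcard).injective
    rw [← hfe, ← hfe, hkl]
  · have h1 := hlt k l hkl
    rcases htri _ (he k) _ (he l) (fun h => by rw [h] at h1; exact h1.false) with h | h
    · exact h
    · exact absurd (hmono _ (he l) _ (he k) h) (by omega)

/-- Curtains are thick: each member of a chain that separates `x` from `y` contributes at least the
length of its pole to the distance. -/
theorem card_le_dist_of_below {n : ℕ} : ∀ {c : Fin n → Curtain X} {x y : X},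
    (∀ k, x ∈ (c k).neg ∧ y ∈ (c k).pos) → (∀ k l, k < l → (c k).Below (c l)) →
    (n : ℝ) ≤ dist x y := by
  induction n with
  | zero => intro _ x y _ _; simp
  | succ n ih =>
    intro c x y hxy hc
    obtain ⟨w, hw, hwe⟩ := (c (Fin.last n)).exists_between_proj_eq (hxy _).1 (hxy _).2
    have h1 := ih (c := fun k => c k.castSucc) (x := x) (y := w) (fun k => ⟨(hxy _).1, ?_⟩)
      fun k l hkl => hc _ _ (Fin.castSucc_lt_castSucc_iff.2 hkl)
    · have h2 := (c (Fin.last n)).abs_proj_sub_le w y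
      have h3 := (Curtain.mem_pos _).1 (hxy (Fin.last n)).2
      rw [hwe] at h2
      have := neg_le_abs ((c (Fin.last n)).r - 1 / 2 - (c (Fin.last n)).proj y)
      push_cast
      linarith
    · refine (hc _ _ (Fin.castSucc_lt_last k)).carrier_subset_pos ?_
      rw [Curtain.mem_carrier, hwe]
      constructor <;> linarith

theorem card_le_dist {ι : Type*} (s : Finset ι) (c : ι → Curtain X)
    (hd : ∀ i ∈ s, ∀ j ∈ s, i ≠ j → Disjoint (c i).carrier (c j).carrier) {x y : X}
    (hs : ∀ i ∈ s, (c i).Separates {x} {y}) : (s.card : ℝ) ≤ dist x y := by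
  obtain ⟨e, c', -, h1, h2⟩ := exists_sorted s c hd hs
  exact card_le_dist_of_below (fun k => (h1 k).2.2) h2

/-- A member of a chain separates all its predecessors from all its successors. -/
theorem IsChain.separates {n : ℕ} {c : Fin n → Curtain X} (hc : IsChain c) {i j k : Fin n}
    (hij : i < j) (hjk : j < k) : (c j).Separates (c i).carrier (c k).carrier := by
  have hA : ∀ (d : ℕ) (i j k : Fin n), j.val = i.val + d + 1 → k.val = j.val + 1 →
      (c j).Separates (c i).carrier (c k).carrier := by
    intro d
    induction d with
    | zero => exact fun i j k hj hk => hc.2 i j k hj hk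
    | succ d ih =>
      intro i j k hj hk
      have h1 := ih i ⟨i.val + d + 1, by omega⟩ j rfl (by simp only; omega)
      exact h1.trans (hc.2 _ j k (by simp only; omega) hk)
  have hB : ∀ (d : ℕ) (k : Fin n), k.val = j.val + d + 1 →
      (c j).Separates (c i).carrier (c k).carrier := by
    intro d
    induction d with
    | zero =>
      exact fun k hk => hA (j.val - i.val - 1) i j k (by have := Fin.lt_def.1 hij; omega) hk
    | succ d ih =>
      intro k hk
      have h1 := ih ⟨j.val + d + 1, by omega⟩ rfl
      have h2 := hA d j ⟨j.val + d + 1, by omega⟩ k rfl (by simp only; omega)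
      exact (h2.symm.trans h1.symm).symm
  have := Fin.lt_def.1 hjk
  exact hB (k.val - j.val - 1) k (by omega)

/-- A chain whose members all meet a ball is bounded in terms of the radius. -/
theorem IsChain.card_le_of_dist_le {n : ℕ} {c : Fin n → Curtain X} (hc : IsChain c) {o : X} {R : ℝ}
    (hR : 0 ≤ R) (hm : ∀ i, ∃ p ∈ (c i).carrier, dist p o ≤ R) : (n : ℝ) ≤ 2 * R + 2 := by
  match n, c, hc, hm with
  | 0, _, _, _ => simp; linarith
  | 1, _, _, _ => simp; linarith
  | m + 2, c, hc, hm =>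
    obtain ⟨p, hp, hpo⟩ := hm 0
    obtain ⟨q, hq, hqo⟩ := hm (Fin.last _)
    have := card_le_dist (Finset.univ : Finset (Fin m)) (fun i => c i.succ.castSucc)
      (x := p) (y := q) (fun i _ j _ hij => hc.1 _ _ (by
        intro h; exact hij (Fin.succ_injective _ (Fin.castSucc_injective _ h))))
      fun i _ => (hc.separates (i := 0) (k := Fin.last _) (Fin.lt_def.2 (by simp))
        (Fin.lt_def.2 (by simp))).mono (by simpa using hp) (by simpa using hq)
    rw [Finset.card_univ, Fintype.card_fin] at this
    have h2 := dist_triangle_right p q o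
    push_cast
    linarith

/-! ### Separated curtains are bottlenecks -/

/-- Two segments at `y` that point in opposite directions cannot both make an angle less than
`π / 2` with a geodesic issuing from `y`. -/
theorem isFoot_zero_or_isFoot_zero {σ : ℝ → X} {l : ℝ} (hσ : IsGeodesicOn σ (Set.Icc 0 l))
    (hl : 0 ≤ l) {u v : X} (huv : dist u (σ 0) + dist (σ 0) v = dist u v) :
    IsFoot σ (Set.Icc 0 l) u 0 ∨ IsFoot σ (Set.Icc 0 l) v 0 := by
  have hne : (Set.Icc 0 l).Nonempty := ⟨0, le_rfl, hl⟩
  obtain ⟨s, hs⟩ := hσ.exists_isFoot isClosed_Icc hne u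
  obtain ⟨t, ht⟩ := hσ.exists_isFoot isClosed_Icc hne v
  rcases hs.1.1.eq_or_lt with rfl | hs0
  · exact Or.inl hs
  rcases ht.1.1.eq_or_lt with rfl | ht0
  · exact Or.inr ht
  exfalso
  have key : ∀ {p : X} {a m : ℝ}, IsFoot σ (Set.Icc 0 l) p a → 0 < m → m ≤ a →
      dist p (σ m) < dist p (σ 0) := by
    intro p a m ha hm hma
    have ha0 : 0 < a := hm.trans_le hma
    have h0 : (0 : ℝ) ∈ Set.Icc 0 l := ⟨le_rfl, hl⟩
    have h1 := hσ.stewart p h0 ha.1 (l := m / a) (by positivity) (by rwa [div_le_one ha0])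
    rw [show (1 - m / a) * 0 + m / a * a = m by field_simp; ring] at h1
    have h2 := ha.pythagoras hσ h0
    have h3 : 0 < m / a := by positivity
    apply lt_of_pow_lt_pow_left₀ 2 dist_nonneg
    have h4 : 0 < (m / a) * ((2 - m / a) * (a - 0) ^ 2) := by
      have : m / a ≤ 1 := by rwa [div_le_one ha0]
      have : 0 < 2 - m / a := by linarith
      positivity
    have h5 := mul_le_mul_of_nonneg_left h2 h3.le
    nlinarith
  have hm : 0 < min s t := lt_min hs0 ht0
  have h1 := key hs hm (min_le_left _ _)
  have h2 := key ht hm (min_le_right _ _)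
  have h3 := dist_triangle_right u v (σ (min s t))
  rw [dist_comm (σ 0)] at huv
  linarith

/-- The bottleneck property: where a path crosses the middle one of three `L`-separated curtains,
it is close to every geodesic that crosses all three. If `y` is far from the geodesic `β`, then the
curtains dual to the perpendicular from `y` to `β` all meet two of the three curtains. -/
theorem exists_dist_le_of_lSeparated {L : ℕ} {h₁ h₂ h₃ : Curtain X} (h₁₂ : h₁.Below h₂)
    (h₂₃ : h₂.Below h₃) (s₁₂ : LSeparated L h₁ h₂) (s₂₃ : LSeparated L h₂ h₃) {x₁ x₂ y₁ y₂ y : X}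
    (hx₁ : x₁ ∈ h₁.neg) (hx₂ : x₂ ∈ h₁.neg) (hy₁ : y₁ ∈ h₃.pos) (hy₂ : y₂ ∈ h₃.pos)
    (hy : y ∈ h₂.carrier) (hb : dist x₂ y + dist y y₂ = dist x₂ y₂) {β : ℝ → X}
    (hβ : IsGeodesicOn β (Set.Icc 0 (dist x₁ y₁))) (hβ₀ : β 0 = x₁) (hβ₁ : β (dist x₁ y₁) = y₁) :
    ∃ t ∈ Set.Icc 0 (dist x₁ y₁), dist y (β t) ≤ L + 1 := by
  have hxy : 0 ≤ dist x₁ y₁ := dist_nonneg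
  obtain ⟨z, hz⟩ := hβ.exists_isFoot isClosed_Icc ⟨0, le_rfl, hxy⟩ y
  refine ⟨z, hz.1, ?_⟩
  by_contra! hfar
  obtain ⟨σ, hσ, hσ₀, hσ₁⟩ := CAT0Space.exists_geodesic y (β z)
  set d := dist y (β z) with hd
  have hLpos : (0 : ℝ) < L + 1 := by positivity
  have hd0 : 0 < d := hLpos.trans hfar
  set w : ℝ := d / (L + 1) with hw
  have hw1 : 1 < w := by rwa [hw, one_lt_div hLpos]
  have hwd : (L + 1) * w = d := by rw [hw]; field_simp
  -- The poles of `L + 1` curtains dual to `σ`, evenly spaced.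
  have hr₀ : ∀ i : Fin (L + 1), 1 / 2 < ((i : ℕ) + 1 / 2) * w := fun i => by
    have : (0 : ℝ) ≤ (i : ℕ) := by positivity
    nlinarith
  have hr₁ : ∀ i : Fin (L + 1), ((i : ℕ) + 1 / 2) * w + 1 / 2 < d := fun i => by
    have : ((i : ℕ) : ℝ) ≤ L := by exact_mod_cast Nat.lt_succ_iff.1 i.2
    rw [← hwd]
    nlinarith
  set c : Fin (L + 1) → Curtain X := fun i => dualCurtain hσ _ (hr₀ i) (hr₁ i) with hc
  have hchain : IsChain c := by
    apply isChain_of_below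
    intro i j hij
    apply dualCurtain_below
    have : ((i : ℕ) : ℝ) + 1 ≤ (j : ℕ) := by exact_mod_cast Fin.lt_def.1 hij
    nlinarith
  have hβpos : ∀ i, β '' Set.Icc 0 (dist x₁ y₁) ⊆ (c i).pos := by
    rintro i _ ⟨t, ht, rfl⟩
    have hfoot : IsFoot σ (Set.Icc 0 d) (β t) d := by
      refine ⟨⟨hd0.le, le_rfl⟩, fun s hs => ?_⟩
      have hzs : IsFoot β (Set.Icc 0 (dist x₁ y₁)) (σ s) z := hz.of_between (by
        have := hσ.between hs
        rwa [hσ₀, hσ₁] at this)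
      have := hzs.pythagoras hβ ht
      rw [hσ₁, hβ t ht z hz.1, dist_comm]
      apply abs_le_of_sq_le_sq _ dist_nonneg
      nlinarith [sq_nonneg (dist (σ s) (β z))]
    rw [Curtain.mem_pos, dualCurtain_proj_eq hσ _ _ hfoot]
    exact hr₁ i
  have hneg : ∀ {u : X} (i), IsFoot σ (Set.Icc 0 d) u 0 → u ∈ (c i).neg := by
    intro u i hu
    rw [Curtain.mem_neg, dualCurtain_proj_eq hσ _ _ hu]
    have := hr₀ i
    change 0 < ((i : ℕ) + 1 / 2) * w - 1 / 2
    linarith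
  have hyfoot : IsFoot σ (Set.Icc 0 d) y 0 := by
    have := isFoot_self (α := σ) (I := Set.Icc 0 d) (t := 0) ⟨le_rfl, hd0.le⟩
    rwa [hσ₀] at this
  have hβconn : IsPreconnected (β '' Set.Icc 0 (dist x₁ y₁)) :=
    isPreconnected_Icc.image _ hβ.continuousOn
  have hx₁β : x₁ ∈ β '' Set.Icc 0 (dist x₁ y₁) := ⟨0, ⟨le_rfl, hxy⟩, hβ₀⟩
  have hy₁β : y₁ ∈ β '' Set.Icc 0 (dist x₁ y₁) := ⟨_, ⟨hxy, le_rfl⟩, hβ₁⟩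
  have hmeet : ∀ (h : Curtain X), x₁ ∈ h.neg → y₁ ∈ h.pos →
      ∀ u ∈ h.carrier, IsFoot σ (Set.Icc 0 d) u 0 → ∀ i, ((c i).carrier ∩ h.carrier).Nonempty := by
    intro h hx hy' u hu hfoot i
    obtain ⟨q, hq, hq'⟩ := h.inter_carrier_nonempty hβconn hx₁β hy₁β hx hy'
    exact (c i).inter_carrier_nonempty h.isPreconnected_carrier hu hq (hneg i hfoot) (hβpos i hq')
  have hm₂ := hmeet h₂ (h₁₂.neg_subset hx₁) (h₂₃.pos_subset hy₁) y hy hyfoot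
  obtain ⟨u, hu, hub⟩ := h₁.exists_between_mem_carrier hx₂ (h₁₂.carrier_subset_pos hy)
  obtain ⟨v, hv, hvb⟩ := h₃.exists_between_mem_carrier (h₂₃.carrier_subset hy) hy₂
  have huv : dist u (σ 0) + dist (σ 0) v = dist u v := by
    rw [hσ₀]
    have h1 := dist_triangle u y v
    have h2 := dist_triangle x₂ u y₂
    have h3 := dist_triangle u v y₂
    linarith
  rcases isFoot_zero_or_isFoot_zero hσ hd0.le huv with hf | hf
  · have hm₁ := hmeet h₁ hx₁ ((h₁₂.trans h₂₃).pos_subset hy₁) u hu hf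
    have := s₁₂.2 (L + 1) c hchain fun i => ⟨hm₁ i, hm₂ i⟩
    omega
  · have hm₃ := hmeet h₃ ((h₁₂.trans h₂₃).neg_subset hx₁) hy₁ v hv hf
    have := s₂₃.2 (L + 1) c hchain fun i => ⟨hm₂ i, hm₃ i⟩
    omega

end

section

/-! ### Translation lengths -/

theorem zpow_add_apply (g : X ≃ᵢ X) (m n : ℤ) (x : X) : (g ^ (m + n)) x = (g ^ m) ((g ^ n) x) := by
  rw [zpow_add]; rfl

theorem pow_add_apply (g : X ≃ᵢ X) (m n : ℕ) (x : X) : (g ^ (m + n)) x = (g ^ m) ((g ^ n) x) := by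
  rw [pow_add]; rfl

theorem pow_invariant {d : X → X → ℝ≥0∞} {g : X ≃ᵢ X} (hinv : ∀ x y, d (g x) (g y) = d x y) (n : ℕ)
    (x y : X) : d ((g ^ n) x) ((g ^ n) y) = d x y := by
  induction n with
  | zero => rfl
  | succ n ih => rw [add_comm, pow_add_apply, pow_add_apply, pow_one, hinv, ih]

/-- Fekete's lemma: a `g`-invariant finite distance function has a translation length, and it is a
lower bound for `d x (g ^ n x) / n`. -/
theorem exists_hasTranslationLength [Nonempty X] {d : X → X → ℝ≥0∞} (hfin : ∀ x y, d x y ≠ ∞)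
    (htri : ∀ x y z, d x z ≤ d x y + d y z) (hsymm : ∀ x y, d x y = d y x) {g : X ≃ᵢ X}
    (hinv : ∀ x y, d (g x) (g y) = d x y) :
    ∃ t : ℝ≥0, HasTranslationLength d g t ∧ ∀ (x : X) (n : ℕ), t * n ≤ (d x ((g ^ n) x)).toReal := by
  have htri' : ∀ x y z, (d x z).toReal ≤ (d x y).toReal + (d y z).toReal := fun x y z => by
    rw [← ENNReal.toReal_add (hfin _ _) (hfin _ _)]
    exact ENNReal.toReal_mono (ENNReal.add_ne_top.2 ⟨hfin _ _, hfin _ _⟩) (htri x y z)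
  have hsub : ∀ x, Subadditive fun n : ℕ => (d x ((g ^ n) x)).toReal := fun x m n => by
    have := htri' x ((g ^ m) x) ((g ^ (m + n)) x)
    rwa [pow_add_apply, pow_invariant hinv, ← pow_add_apply] at this
  have hbdd : ∀ x, BddBelow (Set.range fun n : ℕ => (d x ((g ^ n) x)).toReal / n) := fun x =>
    ⟨0, by rintro _ ⟨n, rfl⟩; positivity⟩
  have hlim := fun x => (hsub x).tendsto_lim (hbdd x)
  have heq : ∀ x y, (hsub x).lim = (hsub y).lim := by
    intro x y
    have h0 : Tendsto (fun n : ℕ => 2 * (d x y).toReal / n) atTop (𝓝 0) :=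
      tendsto_const_nhds.div_atTop tendsto_natCast_atTop_atTop
    have hle : ∀ x y (n : ℕ), (d y ((g ^ n) y)).toReal / n ≤
        (d x ((g ^ n) x)).toReal / n + 2 * (d x y).toReal / n := fun x y n => by
      rw [← add_div]
      gcongr
      have h1 := htri' y x ((g ^ n) y)
      have h2 := htri' x ((g ^ n) x) ((g ^ n) y)
      rw [pow_invariant hinv] at h2
      rw [hsymm y x] at h1
      linarith
    apply le_antisymm
    · have := le_of_tendsto_of_tendsto' (hlim x) ((hlim y).add (by simpa only [hsymm x y] using h0))
        (hle y x)
      simpa using this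
    · have := le_of_tendsto_of_tendsto' (hlim y) ((hlim x).add h0) (hle x y)
      simpa using this
  obtain ⟨x₀⟩ := ‹Nonempty X›
  have h0 : 0 ≤ (hsub x₀).lim := ge_of_tendsto' (hlim x₀) fun n => by positivity
  refine ⟨⟨(hsub x₀).lim, h0⟩, fun x => ?_, fun x n => ?_⟩
  · have h1 : Tendsto (fun n : ℕ => ENNReal.ofReal ((d x ((g ^ n) x)).toReal / n)) atTop
        (𝓝 (ENNReal.ofReal (hsub x).lim)) := ENNReal.tendsto_ofReal (hlim x)
    rw [heq x x₀, ENNReal.ofReal_eq_coe_nnreal h0] at h1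
    refine h1.congr' ?_
    filter_upwards [eventually_gt_atTop 0] with n hn
    rw [ENNReal.ofReal_div_of_pos (by exact_mod_cast hn), ENNReal.ofReal_toReal (hfin _ _),
      ENNReal.ofReal_natCast]
  · rcases n.eq_zero_or_pos with rfl | hn
    · simp
    · have := (hsub x).lim_le_div (hbdd x) hn.ne'
      rw [le_div_iff₀ (by exact_mod_cast hn), heq x x₀] at this
      exact this

theorem HasTranslationLength.unique [Nonempty X] {d : X → X → ℝ≥0∞} {g : X ≃ᵢ X} {s t : ℝ≥0}
    (hs : HasTranslationLength d g s) (ht : HasTranslationLength d g t) : s = t := by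
  obtain ⟨x⟩ := ‹Nonempty X›
  exact_mod_cast tendsto_nhds_unique (hs x) (ht x)

theorem HasTranslationLength.tendsto_toReal {d : X → X → ℝ≥0∞} {g : X ≃ᵢ X} {t : ℝ≥0}
    (ht : HasTranslationLength d g t) (x : X) :
    Tendsto (fun n : ℕ => (d x ((g ^ n) x)).toReal / n) atTop (𝓝 t) := by
  have := (ENNReal.tendsto_toReal ENNReal.coe_ne_top).comp (ht x)
  simpa only [Function.comp_def, ENNReal.toReal_div, ENNReal.toReal_natCast,
    ENNReal.coe_toReal] using this

theorem mul_abs_sub_le_dist [Nonempty X] {g : X ≃ᵢ X} {τ : ℝ≥0}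
    (hτ : HasTranslationLength edist g τ) (x : X) (i j : ℤ) :
    τ * |(i : ℝ) - j| ≤ dist ((g ^ i) x) ((g ^ j) x) := by
  wlog hij : i ≤ j generalizing i j with H
  · rw [abs_sub_comm, dist_comm]; exact H j i (le_of_not_ge hij)
  obtain ⟨t, ht, hle⟩ := exists_hasTranslationLength (d := edist) (g := g)
    (fun x y : X => edist_ne_top x y) edist_triangle edist_comm fun x y => g.edist_eq x y
  obtain ⟨n, rfl⟩ := Int.le.dest hij
  have := hle x n
  rw [← dist_edist] at this
  rw [zpow_add_apply, (g ^ i).dist_eq, hτ.unique ht]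
  push_cast
  rw [sub_add_cancel_left, abs_neg, abs_of_nonneg (by positivity), zpow_natCast]
  exact this

theorem dist_le_mul_abs_sub (g : X ≃ᵢ X) (x : X) (i j : ℤ) :
    dist ((g ^ i) x) ((g ^ j) x) ≤ dist x (g x) * |(i : ℝ) - j| := by
  wlog hij : i ≤ j generalizing i j with H
  · rw [abs_sub_comm, dist_comm]; exact H j i (le_of_not_ge hij)
  obtain ⟨n, rfl⟩ := Int.le.dest hij
  rw [zpow_add_apply, (g ^ i).dist_eq]
  push_cast
  rw [sub_add_cancel_left, abs_neg, abs_of_nonneg (by positivity), zpow_natCast]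
  clear hij
  induction n with
  | zero => simp
  | succ n ih =>
    have := dist_triangle x ((g ^ n) x) ((g ^ (n + 1)) x)
    rw [pow_add_apply g n 1, (g ^ n).dist_eq, pow_one] at this
    rw [pow_add_apply g n 1, pow_one]
    push_cast
    linarith

theorem isQIEmbedding_orbit [Nonempty X] {g : X ≃ᵢ X} {τ : ℝ≥0}
    (hτ : HasTranslationLength edist g τ) (hpos : 0 < τ) (x : X) :
    IsQIEmbedding fun n : ℤ => (g ^ n) x := by
  have hτ0 : (0 : ℝ) < τ := by exact_mod_cast hpos
  refine ⟨max 1 (max (τ : ℝ)⁻¹ (dist x (g x))), 0, le_max_left _ _, le_rfl, fun m n => ⟨?_, ?_⟩⟩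
  · rw [sub_zero]
    refine le_trans ?_ (mul_abs_sub_le_dist hτ x m n)
    rw [div_le_iff₀ (by positivity)]
    have h1 : (τ : ℝ)⁻¹ ≤ max 1 (max (τ : ℝ)⁻¹ (dist x (g x))) :=
      (le_max_left _ _).trans (le_max_right _ _)
    calc |(m : ℝ) - n| = τ * |(m : ℝ) - n| * (τ : ℝ)⁻¹ := by field_simp
      _ ≤ _ := by gcongr
  · rw [add_zero]
    refine (dist_le_mul_abs_sub g x m n).trans ?_
    gcongr
    exact (le_max_right _ _).trans (le_max_right _ _)

/-! ### The metrics `d_L` and `D` -/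

theorem ExistsLChain.symm {L n : ℕ} {x y : X} (h : ExistsLChain L x y n) : ExistsLChain L y x n :=
  h.imp fun _ hc => ⟨hc.1, fun i => (hc.2 i).symm⟩

theorem ExistsLChain.map {L n : ℕ} {x y : X} (h : ExistsLChain L x y n) (g : X ≃ᵢ X) :
    ExistsLChain L (g x) (g y) n := by
  obtain ⟨c, hc, hs⟩ := h
  refine ⟨fun i => (c i).map g, ⟨hc.1.map g, fun i j hij => (hc.2 i j hij).map g⟩, fun i => ?_⟩
  simpa using (hs i).map g

theorem existsLChain_zero (L : ℕ) (x y : X) : ExistsLChain L x y 0 :=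
  ⟨Fin.elim0, ⟨⟨fun i => i.elim0, fun i => i.elim0⟩, fun i => i.elim0⟩, fun i => i.elim0⟩

theorem distL_self (L : ℕ) (x : X) : distL L x x = 0 := if_pos rfl

theorem distL_comm (L : ℕ) (x y : X) : distL L x y = distL L y x := by
  have : ∀ n, ExistsLChain L x y n ↔ ExistsLChain L y x n := fun n => ⟨.symm, .symm⟩
  by_cases hxy : x = y
  · rw [hxy]
  · simp only [distL, this, if_neg hxy, if_neg (Ne.symm hxy)]

theorem distL_map (L : ℕ) (g : X ≃ᵢ X) (x y : X) : distL L (g x) (g y) = distL L x y := by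
  have : ∀ n, ExistsLChain L (g x) (g y) n ↔ ExistsLChain L x y n := fun n =>
    ⟨fun h => by simpa using h.map g.symm, fun h => h.map g⟩
  by_cases hxy : x = y
  · rw [hxy, distL_self, distL_self]
  · simp only [distL, this, if_neg hxy, if_neg (g.injective.ne hxy)]

variable [CAT0Space X]

theorem ExistsLChain.le_dist {L n : ℕ} {x y : X} (h : ExistsLChain L x y n) :
    (n : ℝ) ≤ dist x y := by
  obtain ⟨c, hc, hs⟩ := h
  simpa using card_le_dist Finset.univ c (fun i _ j _ hij => hc.1.1 i j hij) fun i _ => hs i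

theorem existsLChain_card {L : ℕ} {ι : Type*} (s : Finset ι) (c : ι → Curtain X)
    (hd : ∀ i ∈ s, ∀ j ∈ s, i ≠ j → LSeparated L (c i) (c j)) {x y : X}
    (hs : ∀ i ∈ s, (c i).Separates {x} {y}) : ExistsLChain L x y s.card := by
  obtain ⟨e, c', he, h₁, h₂⟩ := exists_sorted s c (fun i hi j hj hij => (hd i hi j hj hij).1) hs
  refine ⟨c', ⟨isChain_of_below h₂, fun i j hij => ?_⟩, fun i => Or.inl ?_⟩
  · exact (hd _ (h₁ i).1 _ (h₁ j).1 (he.ne hij)).congr (h₁ i).2.1.1 (h₁ j).2.1.1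
  · simpa using (h₁ i).2.2

/-- The supremum in the definition of `d_L` is a maximum. -/
theorem exists_distL_eq (L : ℕ) {x y : X} (hxy : x ≠ y) :
    ∃ n, ExistsLChain L x y n ∧ distL L x y = 1 + n ∧ ∀ m, ExistsLChain L x y m → m ≤ n := by
  have hbdd : BddAbove {n | ExistsLChain L x y n} :=
    ⟨⌊dist x y⌋₊, fun n hn => Nat.le_floor (ExistsLChain.le_dist hn)⟩
  have hmem : ExistsLChain L x y (sSup {n | ExistsLChain L x y n}) :=
    Nat.sSup_mem ⟨0, existsLChain_zero L x y⟩ hbdd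
  have hle : ∀ m, ExistsLChain L x y m → m ≤ sSup {n | ExistsLChain L x y n} :=
    fun m hm => le_csSup hbdd hm
  refine ⟨_, hmem, ?_, hle⟩
  rw [distL, if_neg hxy]
  congr 1
  refine le_antisymm (iSup₂_le fun m hm => by exact_mod_cast hle m hm) ?_
  exact le_iSup₂ (f := fun (n : ℕ) (_ : ExistsLChain L x y n) => (n : ℝ≥0∞)) _ hmem

theorem natCast_le_distL {L n : ℕ} {x y : X} (h : ExistsLChain L x y n) :
    (n : ℝ≥0∞) ≤ distL L x y := by
  by_cases hxy : x = y
  · subst hxy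
    have := h.le_dist
    rw [dist_self] at this
    have : n = 0 := by exact_mod_cast this.antisymm n.cast_nonneg
    simp [this]
  · obtain ⟨m, -, hm, hle⟩ := exists_distL_eq L hxy
    rw [hm]
    calc (n : ℝ≥0∞) ≤ m := by exact_mod_cast hle n h
      _ ≤ 1 + m := le_add_self

theorem distL_le (L : ℕ) (x y : X) : distL L x y ≤ 1 + edist x y := by
  by_cases hxy : x = y
  · subst hxy; simp [distL_self]
  · obtain ⟨m, hm, he, -⟩ := exists_distL_eq L hxy
    rw [he]
    gcongr
    rw [edist_dist, ← ENNReal.ofReal_natCast]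
    exact ENNReal.ofReal_le_ofReal hm.le_dist

theorem distL_ne_top (L : ℕ) (x y : X) : distL L x y ≠ ∞ :=
  ne_top_of_le_ne_top (ENNReal.add_ne_top.2 ⟨ENNReal.one_ne_top, edist_ne_top x y⟩) (distL_le L x y)

/-- The members of a finite family of disjoint curtains that separate `x` from `z` are classified
by their position relative to `y`; at most one of them contains `y`. -/
theorem card_le_card_add_card {ι : Type*} (s : Finset ι) (c : ι → Curtain X)
    (hd : ∀ i ∈ s, ∀ j ∈ s, i ≠ j → Disjoint (c i).carrier (c j).carrier) {x z : X}
    (hs : ∀ i ∈ s, (c i).Separates {x} {z}) (y : X) :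
    ∃ t ⊆ s, ∃ u ⊆ s, s.card ≤ t.card + u.card + 1 ∧ (∀ i ∈ t, (c i).Separates {x} {y}) ∧
      ∀ i ∈ u, (c i).Separates {y} {z} := by
  classical
  refine ⟨s.filter fun i => (c i).Separates {x} {y}, Finset.filter_subset _ _,
    s.filter fun i => (c i).Separates {y} {z}, Finset.filter_subset _ _, ?_,
    fun i hi => (Finset.mem_filter.1 hi).2, fun i hi => (Finset.mem_filter.1 hi).2⟩
  have h1 : (s.filter fun i => y ∈ (c i).carrier).card ≤ 1 := by
    rw [Finset.card_le_one]
    intro i hi j hj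
    by_contra hne
    rw [Finset.mem_filter] at hi hj
    exact Set.disjoint_left.1 (hd i hi.1 j hj.1 hne) hi.2 hj.2
  have h2 : s ⊆ ((s.filter fun i => (c i).Separates {x} {y}) ∪
      (s.filter fun i => (c i).Separates {y} {z})) ∪ s.filter fun i => y ∈ (c i).carrier := by
    intro i hi
    have hi' := hs i hi
    simp only [Finset.mem_union, Finset.mem_filter, hi, true_and]
    simp only [Curtain.Separates, Set.singleton_subset_iff] at hi' ⊢
    by_cases hn : y ∈ (c i).neg
    · tauto
    by_cases hp : y ∈ (c i).pos
    · tauto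
    exact Or.inr ((c i).mem_carrier_of_not_mem hn hp)
  have h3 := Finset.card_le_card h2
  have h4 := Finset.card_union_le ((s.filter fun i => (c i).Separates {x} {y}) ∪
      (s.filter fun i => (c i).Separates {y} {z})) (s.filter fun i => y ∈ (c i).carrier)
  have h5 := Finset.card_union_le (s.filter fun i => (c i).Separates {x} {y})
      (s.filter fun i => (c i).Separates {y} {z})
  omega

theorem distL_triangle (L : ℕ) (x y z : X) : distL L x z ≤ distL L x y + distL L y z := by
  by_cases hxz : x = z
  · subst hxz; simp [distL_self]
  by_cases hxy : x = y
  · subst hxy; simp [distL_self]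
  by_cases hyz : y = z
  · subst hyz; simp [distL_self]
  obtain ⟨n, ⟨c, hc, hs⟩, hn, -⟩ := exists_distL_eq L hxz
  obtain ⟨a, -, ha, hle⟩ := exists_distL_eq L hxy
  obtain ⟨b, -, hb, hle'⟩ := exists_distL_eq L hyz
  obtain ⟨t, -, u, -, hcard, ht, hu⟩ := card_le_card_add_card Finset.univ c
    (fun i _ j _ hij => hc.1.1 i j hij) (fun i _ => hs i) y
  have h1 := hle _ (existsLChain_card t c (fun i _ j _ hij => hc.2 i j hij) ht)
  have h2 := hle' _ (existsLChain_card u c (fun i _ j _ hij => hc.2 i j hij) hu)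
  rw [Finset.card_univ, Fintype.card_fin] at hcard
  rw [hn, ha, hb]
  have : 1 + n ≤ (1 + a) + (1 + b) := by omega
  exact_mod_cast this

theorem exists_hasTranslationLength_distL [Nonempty X] (L : ℕ) (g : X ≃ᵢ X) :
    ∃ t : ℝ≥0, HasTranslationLength (distL L) g t ∧
      ∀ (x : X) (n : ℕ), t * n ≤ (distL L x ((g ^ n) x)).toReal :=
  exists_hasTranslationLength (distL_ne_top L) (distL_triangle L) (distL_comm L) (distL_map L g)

theorem tsum_ofReal_weight {lam : ℕ+ → ℝ} (hlam : IsWeight lam) :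
    ∑' L, ENNReal.ofReal (lam L) = 1 := by
  rw [← ENNReal.ofReal_tsum_of_nonneg (fun L => (hlam.pos L).le) hlam.hasSum.summable,
    hlam.hasSum.tsum_eq, ENNReal.ofReal_one]

theorem exists_hasTranslationLength_distD [Nonempty X] {lam : ℕ+ → ℝ} (hlam : IsWeight lam)
    (g : X ≃ᵢ X) : ∃ t : ℝ≥0, HasTranslationLength (distD lam) g t := by
  suffices h : ∃ t : ℝ≥0, HasTranslationLength (distD lam) g t ∧
      ∀ (x : X) (n : ℕ), t * n ≤ (distD lam x ((g ^ n) x)).toReal from h.imp fun _ ht => ht.1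
  refine exists_hasTranslationLength (fun x y => ?_) (fun x y z => ?_) (fun x y => ?_) fun x y => ?_
  · have : distD lam x y ≤ 1 + edist x y := by
      calc distD lam x y ≤ ∑' L, ENNReal.ofReal (lam L) * (1 + edist x y) :=
            ENNReal.tsum_le_tsum fun L => mul_le_mul_right (distL_le _ _ _) _
        _ = 1 + edist x y := by rw [ENNReal.tsum_mul_right, tsum_ofReal_weight hlam, one_mul]
    exact ne_top_of_le_ne_top (ENNReal.add_ne_top.2 ⟨ENNReal.one_ne_top, edist_ne_top x y⟩) this
  · rw [distD, distD, distD, ← ENNReal.tsum_add]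
    refine ENNReal.tsum_le_tsum fun L => ?_
    rw [← mul_add]
    exact mul_le_mul_right (distL_triangle _ _ _ _) _
  · simp only [distD, distL_comm _ x y]
  · simp only [distD, distL_map]

/-- The translation length for `D` is `∑ λ_L` times the translation length for `d_L`, by dominated
convergence. -/
theorem isLoxodromic_distD_iff [Nonempty X] {lam : ℕ+ → ℝ} (hlam : IsWeight lam) (g : X ≃ᵢ X) :
    IsLoxodromic (distD lam) g ↔ ∃ L : ℕ+, IsLoxodromic (distL (L : ℕ)) g := by
  choose t ht using fun L : ℕ+ => exists_hasTranslationLength_distL (L : ℕ) g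
  obtain ⟨T, hT⟩ := exists_hasTranslationLength_distD hlam g
  obtain ⟨x⟩ := ‹Nonempty X›
  let _ : MeasurableSpace ℕ+ := ⊤
  have : DiscreteMeasurableSpace ℕ+ := ⟨fun _ => trivial⟩
  have hsum : Tendsto (fun n : ℕ => distD lam x ((g ^ n) x) / (n : ℝ≥0∞)) atTop
      (𝓝 (∑' L, ENNReal.ofReal (lam L) * t L)) := by
    have := MeasureTheory.tendsto_lintegral_filter_of_dominated_convergence
      (μ := MeasureTheory.Measure.count) (l := atTop)
      (F := fun (n : ℕ) (L : ℕ+) =>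
        ENNReal.ofReal (lam L) * (distL (L : ℕ) x ((g ^ n) x) / (n : ℝ≥0∞)))
      (f := fun L => ENNReal.ofReal (lam L) * t L)
      (fun L => ENNReal.ofReal (lam L) * (1 + edist x (g x)))
      (Eventually.of_forall fun n => measurable_of_countable _) ?_ ?_ ?_
    · simp only [MeasureTheory.lintegral_count] at this
      refine this.congr fun n => ?_
      simp only [distD, div_eq_mul_inv, ← mul_assoc]
      rw [ENNReal.tsum_mul_right]
    · filter_upwards [eventually_gt_atTop 0] with n hn
      refine Eventually.of_forall fun L => mul_le_mul_right ?_ _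
      have hn1 : (1 : ℝ≥0∞) ≤ n := by exact_mod_cast hn
      apply ENNReal.div_le_of_le_mul
      refine (distL_le _ _ _).trans ?_
      rw [add_mul, one_mul]
      gcongr
      have := dist_le_mul_abs_sub g x 0 n
      rw [edist_dist, edist_dist, ← ENNReal.ofReal_natCast, ← ENNReal.ofReal_mul dist_nonneg]
      apply ENNReal.ofReal_le_ofReal
      simpa using this
    · rw [MeasureTheory.lintegral_count, ENNReal.tsum_mul_right, tsum_ofReal_weight hlam, one_mul]
      exact ENNReal.add_ne_top.2 ⟨ENNReal.one_ne_top, edist_ne_top _ _⟩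
    · exact Eventually.of_forall fun L =>
        ENNReal.Tendsto.const_mul ((ht L).1 x) (Or.inr ENNReal.ofReal_ne_top)
  have hTt : (T : ℝ≥0∞) = ∑' L, ENNReal.ofReal (lam L) * t L := tendsto_nhds_unique (hT x) hsum
  have : Nonempty X := ⟨x⟩
  constructor
  · rintro ⟨s, hs, hs'⟩
    by_contra! hno
    have h0 : ∀ L, t L = 0 := fun L => by
      by_contra h
      exact hno L ⟨t L, pos_iff_ne_zero.2 h, (ht L).1⟩
    rw [hs'.unique hT] at hs
    simp [h0] at hTt
    exact hs.ne' hTt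
  · rintro ⟨L, s, hs, hs'⟩
    refine ⟨T, ?_, hT⟩
    rw [hs'.unique (ht L).1] at hs
    rw [← ENNReal.coe_pos, hTt]
    refine lt_of_lt_of_le ?_ (ENNReal.le_tsum L)
    exact ENNReal.mul_pos (ENNReal.ofReal_pos.2 (hlam.pos L)).ne' (by exact_mod_cast hs.ne')

end

/-! ### Bottleneck systems -/

/-- A coarse axiomatization of a contracting line: a quasi-isometrically embedded sequence of points
`x k`, together with a "left side" `N k` and a "right side" `P k` at every `k`, such that every two
points, one to the left of `k` and the other one to the right of `k + K`, are joined by a geodesic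
that passes through the ball of radius `R` about `x k`. The point `y` at which it does so is
described by the equality case of the triangle inequality. -/
structure BottleneckSystem (x : ℤ → X) (N P : ℤ → Set X) (K : ℕ) (R c Δ : ℝ) : Prop where
  nonneg : 0 ≤ R
  pos : 0 < c
  monotone : Monotone N
  antitone : Antitone P
  mem_left : ∀ {i k}, i ≤ k → x i ∈ N k
  mem_right : ∀ {i k}, k < i → x i ∈ P k
  left_of_not_right : ∀ {p k}, p ∉ P k → p ∈ N (k + 1)
  right_of_not_left : ∀ {p k}, p ∉ N k → p ∈ P (k - 1)
  pass : ∀ {u v k}, u ∈ N k → v ∈ P (k + K) →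
    ∃ y, dist u y + dist y v = dist u v ∧ dist y (x k) ≤ R
  lower : ∀ i j : ℤ, c * |(i : ℝ) - j| ≤ dist (x i) (x j)
  upper : ∀ i j : ℤ, dist (x i) (x j) ≤ Δ * |(i : ℝ) - j|

namespace BottleneckSystem

variable {x : ℤ → X} {N P : ℤ → Set X} {K : ℕ} {R c Δ : ℝ}

theorem lt_dist (S : BottleneckSystem x N P K R c Δ) {B : ℝ} {M : ℕ} (hM : B < c * M) {i j : ℤ}
    (hij : i + M ≤ j) : B < dist (x i) (x j) := by
  refine hM.trans_le (le_trans ?_ (S.lower i j))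
  have : (i : ℝ) + M ≤ j := by exact_mod_cast hij
  refine mul_le_mul_of_nonneg_left ?_ S.pos.le
  rw [abs_sub_comm]
  exact le_trans (by linarith) (le_abs_self _)

/-- If `x l` is about as close to `q` as the points `x m` with `k ≤ m ≤ l`, then `q` lies to the
right of a point slightly before `l`. -/
theorem mem_right_of_dist_le (S : BottleneckSystem x N P K R c Δ) {ρ : ℝ} {M : ℕ}
    (hM : 3 * R + ρ < c * M) (hK : K + 1 ≤ M) {q : X} {l : ℤ}
    (hq : dist q (x l) ≤ dist q (x (l - M)) + ρ) : q ∈ P (l - M - 1) := by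
  apply S.right_of_not_left
  intro hN
  obtain ⟨y, hy, hyR⟩ := S.pass hN (S.mem_right (i := l) (by omega))
  have h1 := dist_triangle q y (x (l - M))
  have h2 := dist_triangle_left (x (l - M)) (x l) y
  have h3 := S.lt_dist hM (i := l - M) (j := l) (by omega)
  have := S.nonneg
  linarith

theorem mem_left_of_dist_le (S : BottleneckSystem x N P K R c Δ) {ρ : ℝ} {M : ℕ}
    (hM : 3 * R + ρ < c * M) {p : X} {k : ℤ}
    (hp : dist p (x k) ≤ dist p (x (k + M)) + ρ) : p ∈ N (k + M + K + 1) := by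
  apply S.left_of_not_right
  intro hP
  obtain ⟨y, hy, hyR⟩ := S.pass (S.mem_left (i := k) (k := k + M) (by omega)) hP
  have h2 := dist_triangle (x k) y (x (k + M))
  have h3 := S.lt_dist hM (i := k) (j := k + M) (by omega)
  rw [dist_comm p, dist_comm p] at hp
  have := S.nonneg
  have h5 := dist_triangle (x (k + M)) y p
  rw [dist_comm (x (k + M)) y] at h5
  linarith

/-- If `p` and `q` are coarsely closest to `x k` and `x l`, and `q` is not further away from `p`
than the points of the sequence, then `k` and `l` are close. -/
theorem abs_sub_lt (S : BottleneckSystem x N P K R c Δ) {ρ : ℝ} {M : ℕ} (hρ : 0 ≤ ρ)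
    (hM : 3 * R + ρ < c * M) (hK : K + 1 ≤ M) {p q : X} {k l : ℤ}
    (hp : ∀ m ∈ Set.uIcc k l, dist p (x k) ≤ dist p (x m) + ρ)
    (hq : ∀ m ∈ Set.uIcc k l, dist q (x l) ≤ dist q (x m) + ρ)
    (hpq : ∀ m ∈ Set.uIcc k l, dist p q ≤ dist p (x m) + ρ) : |k - l| < 7 * M := by
  have hR := S.nonneg
  by_contra! hge
  rcases le_total k l with hkl | hkl
  · rw [abs_sub_comm, abs_of_nonneg (by omega)] at hge
    rw [Set.uIcc_of_le hkl] at hp hq hpq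
    have hpN := S.mem_left_of_dist_le hM (hp (k + M) ⟨by omega, by omega⟩)
    have hqP := S.mem_right_of_dist_le hM hK (hq (l - M) ⟨by omega, by omega⟩)
    set s := k + M + K + 1 with hs
    set u := l - M - 1 - K with hu
    -- A geodesic from `p` to `q` passes first through a point `z` near `x s` and then through a
    -- point `y` near `x u`, so that `dist p q` exceeds `dist p (x s)` by about `dist (x s) (x u)`.
    obtain ⟨y, hy, hyR⟩ := S.pass (k := u) (S.monotone (by omega : s ≤ u) hpN)
      (v := q) (by rw [hu, sub_add_cancel]; exact hqP)
    have hyP : y ∈ P (s + K) := by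
      by_contra hc
      obtain ⟨z, hz, hzR⟩ := S.pass (S.left_of_not_right hc)
        (S.mem_right (i := u) (k := s + K + 1 + K) (by omega))
      have h1 := S.lt_dist hM (i := s + K + 1) (j := u) (by omega)
      have h2 := dist_triangle_left (x (s + K + 1)) (x u) z
      have := dist_nonneg (x := y) (y := z)
      linarith
    obtain ⟨z, hz, hzR⟩ := S.pass hpN hyP
    have h1 := S.lt_dist hM (i := s) (j := u) (by omega)
    have h2 := hpq s ⟨by omega, by omega⟩
    have h3 := dist_triangle p z (x s)
    have h4 := dist_triangle_left (x s) (x u) z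
    have h5 := dist_triangle z y (x u)
    have := dist_nonneg (x := y) (y := q)
    linarith
  · rw [abs_of_nonneg (by omega)] at hge
    rw [Set.uIcc_of_ge hkl] at hp hq hpq
    have hqN := S.mem_left_of_dist_le hM (hq (l + M) ⟨by omega, by omega⟩)
    have hpP := S.mem_right_of_dist_le hM hK (hp (k - M) ⟨by omega, by omega⟩)
    set u := l + M + K + 1 with hu
    set v := k - M - 1 - K with hv
    -- The same argument, with the roles of left and right exchanged.
    obtain ⟨y, hy, hyR⟩ := S.pass hqN (S.antitone (by omega : u + K ≤ k - M - 1) hpP)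
    have hyN : y ∈ N v := by
      by_contra hc
      obtain ⟨z, hz, hzR⟩ := S.pass (S.mem_left (i := u) (k := v - 1 - K) (by omega))
        (v := y) (by rw [sub_add_cancel]; exact S.right_of_not_left hc)
      have h1 := S.lt_dist hM (i := u) (j := v - 1 - K) (by omega)
      have h2 := dist_triangle (x u) z (x (v - 1 - K))
      have := dist_nonneg (x := z) (y := y)
      rw [dist_comm y] at hyR
      linarith
    obtain ⟨z, hz, hzR⟩ := S.pass hyN (v := p) (by rw [hv, sub_add_cancel]; exact hpP)
    have h1 := S.lt_dist hM (i := u) (j := v) (by omega)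
    have h2 := hpq v ⟨by omega, by omega⟩
    have h4 := dist_triangle (x u) y (x v)
    have h5 := dist_triangle y z (x v)
    have := dist_nonneg (x := q) (y := y)
    rw [dist_comm (x u) y] at h4
    rw [dist_comm p q] at h2
    have h6 := dist_triangle p z (x v)
    rw [dist_comm p z] at h6
    linarith

/-- A set at finite Hausdorff distance from an interval of a bottleneck system is contracting, with
a constant that does not depend on the interval. -/
theorem exists_isContractingSet (S : BottleneckSystem x N P K R c Δ) {δ : ℝ} (hδ : 0 ≤ δ) :
    ∃ C : ℝ, ∀ (A : Set X) (J : Set ℤ), J.OrdConnected → (∀ a ∈ A, ∃ k ∈ J, dist a (x k) ≤ δ) →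
      (∀ k ∈ J, ∃ a ∈ A, dist a (x k) ≤ δ) → IsContractingSet C A := by
  obtain ⟨M₀, hM₀⟩ := exists_nat_gt ((3 * R + (1 + 2 * δ)) / c)
  set M := max M₀ (K + 1) with hMdef
  have hM : 3 * R + (1 + 2 * δ) < c * M := by
    rw [div_lt_iff₀ S.pos] at hM₀
    have : (M₀ : ℝ) ≤ M := by exact_mod_cast le_max_left _ _
    have := mul_le_mul_of_nonneg_left this S.pos.le
    linarith
  have hΔ : 0 ≤ Δ := by
    have := dist_nonneg.trans (S.upper 0 1)
    simpa using this
  refine ⟨2 * (2 * δ + Δ * (7 * M)), fun A J hJ hAJ hJA o r hdisj p hp q hq a ha b hb => ?_⟩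
  have hr : ∀ a' ∈ A, r ≤ dist o a' := fun a' ha' => by
    by_contra! h
    exact Set.disjoint_left.1 hdisj (by rwa [Metric.mem_ball, dist_comm]) ha'
  -- An almost closest point to the centre of the ball.
  obtain ⟨e, he, hemin⟩ : ∃ e ∈ A, ∀ a' ∈ A, dist o e ≤ dist o a' + 1 := by
    have hne : (dist o '' A).Nonempty := ⟨_, a, ha.1, rfl⟩
    have hbdd : BddBelow (dist o '' A) := ⟨0, by rintro _ ⟨a', -, rfl⟩; exact dist_nonneg⟩
    obtain ⟨_, ⟨e, he, rfl⟩, hlt⟩ := Real.lt_sInf_add_pos hne one_pos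
    exact ⟨e, he, fun a' ha' => hlt.le.trans (by
      have := csInf_le hbdd ⟨a', ha', rfl⟩; linarith)⟩
  have key : ∀ p ∈ Metric.ball o r, ∀ a ∈ closestPoints A p,
      dist e a ≤ 2 * δ + Δ * (7 * M) := by
    intro p hp a ha
    rw [Metric.mem_ball, dist_comm] at hp
    obtain ⟨k, hk, hek⟩ := hAJ e he
    obtain ⟨l, hl, hal⟩ := hAJ a ha.1
    have hkl : Set.uIcc k l ⊆ J := Set.OrdConnected.uIcc_subset hJ hk hl
    have hnear : ∀ m ∈ Set.uIcc k l, ∀ z, ∃ a' ∈ A, dist z a' ≤ dist z (x m) + δ := by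
      intro m hm z
      obtain ⟨a', ha', had⟩ := hJA m (hkl hm)
      refine ⟨a', ha', (dist_triangle_right z a' (x m)).trans (by linarith)⟩
    have hlt : |k - l| < 7 * M := by
      refine S.abs_sub_lt (p := o) (q := p) (by linarith) hM (le_max_right _ _)
        (fun m hm => ?_) (fun m hm => ?_) fun m hm => ?_
      · obtain ⟨a', ha', had⟩ := hnear m hm o
        have := hemin a' ha'
        have := dist_triangle o e (x k)
        linarith
      · obtain ⟨a', ha', had⟩ := hnear m hm p
        have := ha.2 a' ha'
        have := dist_triangle p a (x l)
        linarith
      · obtain ⟨a', ha', had⟩ := hnear m hm o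
        have := hr a' ha'
        linarith
    have h1 := S.upper k l
    have h2 : |(k : ℝ) - l| ≤ 7 * M := by exact_mod_cast hlt.le
    have h3 := mul_le_mul_of_nonneg_left h2 hΔ
    have h4 := dist_triangle4 e (x k) (x l) a
    rw [dist_comm (x l) a] at h4
    linarith
  have h1 := key p hp a ha
  have h2 := key q hq b hb
  have h3 := dist_triangle_left a b e
  linarith

end BottleneckSystem

/-! ### Geodesics near contracting sets -/

section Contracting

variable {A : Set X} {pr : X → X} {C : ℝ}

theorem dist_closest_le (hpr : ∀ p, pr p ∈ closestPoints A p) (p q : X) :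
    dist p (pr p) ≤ dist p q + dist q (pr q) :=
  ((hpr p).2 _ (hpr q).1).trans (dist_triangle _ _ _)

theorem IsContractingSet.dist_le (hA : IsContractingSet C A)
    (hpr : ∀ p, pr p ∈ closestPoints A p) {p q : X} (hpq : dist p q < dist p (pr p)) :
    dist (pr p) (pr q) ≤ C := by
  refine hA p (dist p (pr p)) ?_ p ?_ q ?_ _ (hpr p) _ (hpr q)
  · rw [Set.disjoint_left]
    intro a ha haA
    rw [Metric.mem_ball, dist_comm] at ha
    exact absurd ((hpr p).2 a haA) (not_le.2 ha)
  · exact Metric.mem_ball_self (dist_nonneg.trans_lt hpq)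
  · rwa [Metric.mem_ball, dist_comm]

/-- Along a geodesic that stays far away from a contracting set, the projection moves with at most
half speed. -/
theorem IsContractingSet.dist_le_of_far_of_le (hA : IsContractingSet C A)
    (hpr : ∀ p, pr p ∈ closestPoints A p) (hC : 1 ≤ C) {γ : ℝ → X} (n : ℕ) :
    ∀ {a b : ℝ}, a ≤ b → IsGeodesicOn γ (Set.Icc a b) →
      (∀ t ∈ Set.Icc a b, 2 * C + 1 ≤ dist (γ t) (pr (γ t))) → b - a ≤ n * (2 * C) →
      dist (pr (γ a)) (pr (γ b)) ≤ n * C := by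
  induction n with
  | zero =>
    intro a b hab _ _ h
    have : a = b := by simp at h; linarith
    simp [this]
  | succ n ih =>
    intro a b hab hγ hfar h
    push_cast at h ⊢
    have ha : a ∈ Set.Icc a b := ⟨le_rfl, hab⟩
    have hm : min b (a + 2 * C) ∈ Set.Icc a b := ⟨le_min hab (by linarith), min_le_left _ _⟩
    have hsub : Set.Icc (min b (a + 2 * C)) b ⊆ Set.Icc a b := Set.Icc_subset_Icc_left hm.1
    have h1 : dist (pr (γ a)) (pr (γ (min b (a + 2 * C)))) ≤ C := by
      refine hA.dist_le hpr (lt_of_lt_of_le ?_ (hfar a ha))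
      rw [hγ _ ha _ hm, abs_sub_comm, abs_of_nonneg (by linarith [hm.1])]
      have := min_le_right b (a + 2 * C)
      linarith
    have h2 := ih hm.2 (hγ.mono hsub) (fun t ht => hfar t (hsub ht)) (by
      rcases min_choice b (a + 2 * C) with h' | h' <;> rw [h']
      · rw [sub_self]; positivity
      · linarith)
    have := dist_triangle (pr (γ a)) (pr (γ (min b (a + 2 * C)))) (pr (γ b))
    linarith

/-- The projection of a geodesic that stays far away from a contracting set is bounded: the initial
and the final part of it are contained in balls that are disjoint from the set, and the length of
the middle part is at most the distance between the projections of its endpoints. -/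
theorem IsContractingSet.dist_le_of_far (hA : IsContractingSet C A)
    (hpr : ∀ p, pr p ∈ closestPoints A p) (hC : 1 ≤ C) {γ : ℝ → X} {a b : ℝ} (hab : a ≤ b)
    (hγ : IsGeodesicOn γ (Set.Icc a b))
    (hfar : ∀ t ∈ Set.Icc a b, 2 * C + 1 ≤ dist (γ t) (pr (γ t))) :
    dist (pr (γ a)) (pr (γ b)) ≤ 6 * C + 2 := by
  have ha : a ∈ Set.Icc a b := ⟨le_rfl, hab⟩
  have hb : b ∈ Set.Icc a b := ⟨hab, le_rfl⟩
  have hd : ∀ {s t}, s ∈ Set.Icc a b → t ∈ Set.Icc a b → s ≤ t → dist (γ s) (γ t) = t - s := by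
    intro s t hs ht hst
    rw [hγ _ hs _ ht, abs_sub_comm, abs_of_nonneg (by linarith)]
  have hfa := hfar a ha
  have hfb := hfar b hb
  set d₁ := dist (γ a) (pr (γ a))
  set d₂ := dist (γ b) (pr (γ b))
  rcases le_total (b - a) ((d₁ - 1) + (d₂ - 1)) with h | h
  · have hm : min b (a + (d₁ - 1)) ∈ Set.Icc a b := ⟨le_min hab (by linarith), min_le_left _ _⟩
    have h1 : dist (pr (γ a)) (pr (γ (min b (a + (d₁ - 1))))) ≤ C := by
      refine hA.dist_le hpr ?_
      rw [hd ha hm hm.1]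
      have := min_le_right b (a + (d₁ - 1))
      linarith
    have h2 : dist (pr (γ b)) (pr (γ (min b (a + (d₁ - 1))))) ≤ C := by
      refine hA.dist_le hpr ?_
      rw [dist_comm, hd hm hb hm.2]
      rcases min_choice b (a + (d₁ - 1)) with h' | h' <;> rw [h'] <;> linarith
    have := dist_triangle_right (pr (γ a)) (pr (γ b)) (pr (γ (min b (a + (d₁ - 1)))))
    linarith
  · have hs : a + (d₁ - 1) ∈ Set.Icc a b := ⟨by linarith, by linarith⟩
    have ht : b - (d₂ - 1) ∈ Set.Icc a b := ⟨by linarith, by linarith⟩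
    have h1 : dist (pr (γ a)) (pr (γ (a + (d₁ - 1)))) ≤ C := by
      refine hA.dist_le hpr ?_
      rw [hd ha hs hs.1]
      linarith
    have h2 : dist (pr (γ b)) (pr (γ (b - (d₂ - 1)))) ≤ C := by
      refine hA.dist_le hpr ?_
      rw [dist_comm, hd ht hb ht.2]
      linarith
    have hsub : Set.Icc (a + (d₁ - 1)) (b - (d₂ - 1)) ⊆ Set.Icc a b :=
      Set.Icc_subset_Icc hs.1 ht.2
    set D := dist (pr (γ a)) (pr (γ b))
    have hD : b - a ≤ d₁ + D + d₂ := by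
      rw [← hd ha hb hab]
      have := dist_triangle4_right (γ a) (γ b) (pr (γ a)) (pr (γ b))
      linarith
    have hD0 : 0 ≤ D := dist_nonneg
    have h3 := hA.dist_le_of_far_of_le hpr hC ⌈(D + 2) / (2 * C)⌉₊ (by linarith) (hγ.mono hsub)
      (fun t ht => hfar t (hsub ht)) (by
        have := Nat.le_ceil ((D + 2) / (2 * C))
        rw [div_le_iff₀ (by linarith)] at this
        linarith)
    have h4 : (⌈(D + 2) / (2 * C)⌉₊ : ℝ) * C ≤ (D + 2) / 2 + C := by
      have := (Nat.ceil_lt_add_one (a := (D + 2) / (2 * C)) (by positivity)).le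
      calc (⌈(D + 2) / (2 * C)⌉₊ : ℝ) * C ≤ ((D + 2) / (2 * C) + 1) * C := by gcongr
        _ = (D + 2) / 2 + C := by field_simp
    have h5 := dist_triangle4 (pr (γ a)) (pr (γ (a + (d₁ - 1)))) (pr (γ (b - (d₂ - 1))))
      (pr (γ b))
    rw [dist_comm (pr (γ (b - (d₂ - 1))))] at h5
    linarith

variable [CAT0Space X]

/-- Either `u` and `v` have close projections to a contracting set, or a geodesic from `u` to `v`
contains a point near the set whose projection is close to that of `v`: the last point near the
set. -/
theorem IsContractingSet.dist_le_or_exists_near (hA : IsContractingSet C A)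
    (hpr : ∀ p, pr p ∈ closestPoints A p) (hC : 1 ≤ C) (u v : X) :
    dist (pr u) (pr v) ≤ 6 * C + 2 ∨ ∃ w, dist u w + dist w v = dist u v ∧
      dist w (pr w) ≤ 2 * C + 1 ∧ dist (pr w) (pr v) ≤ 6 * C + 2 := by
  obtain ⟨γ, hγ, h₀, h₁⟩ := CAT0Space.exists_geodesic u v
  have hl : 0 ≤ dist u v := dist_nonneg
  set l := dist u v
  have hcont : Continuous fun p => dist p (pr p) := by
    have : LipschitzWith 1 fun p => dist p (pr p) := LipschitzWith.of_le_add fun p q => by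
      have := dist_closest_le hpr p q; linarith
    exact this.continuous
  have hclosed : IsClosed (Set.Icc 0 l ∩ (fun t => dist (γ t) (pr (γ t))) ⁻¹' Set.Iic (2 * C + 1)) :=
    (hcont.comp_continuousOn hγ.continuousOn).preimage_isClosed_of_isClosed isClosed_Icc isClosed_Iic
  rcases Set.eq_empty_or_nonempty
    (Set.Icc 0 l ∩ (fun t => dist (γ t) (pr (γ t))) ⁻¹' Set.Iic (2 * C + 1)) with he | hne
  · left
    have := hA.dist_le_of_far hpr hC hl hγ fun t ht => by
      by_contra! hlt
      exact Set.eq_empty_iff_forall_notMem.1 he t ⟨ht, hlt.le⟩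
    rwa [h₀, h₁] at this
  · right
    obtain ⟨m, ⟨hm, hmC⟩, hmax⟩ :=
      (isCompact_Icc.of_isClosed_subset hclosed Set.inter_subset_left).exists_isGreatest hne
    have hb := hγ.between hm
    rw [h₀, h₁] at hb
    refine ⟨γ m, hb, hmC, ?_⟩
    rcases hm.2.eq_or_lt with h | hlt
    · rw [h, h₁, dist_self]; linarith
    have hgt : ∀ t, m < t → t ≤ l → 2 * C + 1 < dist (γ t) (pr (γ t)) := fun t hmt htl => by
      by_contra! hle
      exact absurd (hmax ⟨⟨hm.1.trans hmt.le, htl⟩, hle⟩) (not_le.2 hmt)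
    have := hA.dist_le_of_far hpr hC hlt.le (hγ.mono (Set.Icc_subset_Icc_left hm.1)) fun t ht => by
      rcases ht.1.eq_or_lt with rfl | hlt'
      · by_contra! hc
        -- The distance to the set changes with at most unit speed.
        have hmem : min l (m + (2 * C + 1 - dist (γ m) (pr (γ m)))) ∈ Set.Icc 0 l :=
          ⟨le_min hl (by linarith [hm.1]), min_le_left _ _⟩
        have h2 := hgt _ (lt_min hlt (by linarith)) hmem.2
        have h3 := dist_closest_le hpr (γ (min l (m + (2 * C + 1 - dist (γ m) (pr (γ m))))))
          (γ m)
        rw [hγ _ hmem _ hm, abs_of_nonneg (by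
          rw [sub_nonneg]; exact le_min hlt.le (by linarith))] at h3
        have := min_le_right l (m + (2 * C + 1 - dist (γ m) (pr (γ m))))
        linarith
      · exact (hgt t hlt' ht.2).le
    rwa [h₁] at this

/-- A discrete intermediate value property along a geodesic. -/
theorem exists_between_crossing (φ : X → ℝ) {s : ℝ} {u v : X} (hu : φ u ≤ s) (hv : s < φ v) :
    ∃ y z, dist u y + dist y v = dist u v ∧ dist u z + dist z v = dist u v ∧ dist y z ≤ 1 ∧
      φ y ≤ s ∧ s < φ z := by
  obtain ⟨γ, hγ, h₀, h₁⟩ := CAT0Space.exists_geodesic u v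
  have hl : 0 ≤ dist u v := dist_nonneg
  have hmem : ∀ n : ℕ, min (dist u v) n ∈ Set.Icc 0 (dist u v) := fun n =>
    ⟨le_min hl n.cast_nonneg, min_le_left _ _⟩
  obtain ⟨n, hn, hn'⟩ : ∃ n : ℕ, φ (γ (min (dist u v) n)) ≤ s ∧
      s < φ (γ (min (dist u v) (n + 1 : ℕ))) := by
    by_contra! hc
    have hall : ∀ n : ℕ, φ (γ (min (dist u v) n)) ≤ s := fun n => by
      induction n with
      | zero => simpa [hl, h₀] using hu
      | succ n ih => exact hc n ih
    have := hall ⌈dist u v⌉₊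
    rw [min_eq_left (Nat.le_ceil _), h₁] at this
    linarith
  have hb := fun n => hγ.between (hmem n)
  simp only [h₀, h₁] at hb
  refine ⟨_, _, hb n, hb (n + 1), ?_, hn, hn'⟩
  rw [hγ _ (hmem _) _ (hmem _)]
  refine (abs_min_sub_min_le_max _ _ _ _).trans ?_
  simp

/-- Geodesics between points with far apart projections to a contracting set pass close to every
point of the set between these projections. The set is parametrized coarsely by the real line, and
`φ p` is the parameter of the closest point `pr p`; the constants depend only on those of the
parametrization. -/
theorem exists_pass {C c Δ : ℝ} (hC : 1 ≤ C) (hc : 0 < c) (hΔ : 0 ≤ Δ) :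
    ∃ T R : ℝ, 0 < T ∧ 0 ≤ R ∧ ∀ (A : Set X) (pr : X → X) (φ : X → ℝ), IsContractingSet C A →
      (∀ p, pr p ∈ closestPoints A p) → (∀ p q, c * |φ p - φ q| ≤ dist (pr p) (pr q)) →
      ∀ (o : X) (s : ℝ), (∀ p, dist o (pr p) ≤ Δ * |s - φ p|) →
      ∀ u v, φ u ≤ s → s + T ≤ φ v → ∃ y, dist u y + dist y v = dist u v ∧ dist y o ≤ R := by
  refine ⟨(13 * C + 8) / c + 1, 8 * C + 3 + Δ * ((C + 4) / c), by positivity, by positivity,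
    fun A pr φ hA hpr hφ o s ho u v hu hv => ?_⟩
  have hT : 0 < (13 * C + 8) / c := by positivity
  obtain ⟨y, z, hy, hz, hyz, hys, hzs⟩ := exists_between_crossing φ hu (by linarith : s < φ v)
  -- If `y` is within distance `1` of the set, the projections are within `4` of each other anyway.
  have hpyz : dist (pr y) (pr z) ≤ C + 4 := by
    by_cases h : dist y z < dist y (pr y)
    · have := hA.dist_le hpr h
      linarith
    · push Not at h
      have h1 := dist_closest_le hpr z y
      have h2 := dist_triangle4 (pr y) y z (pr z)
      rw [dist_comm (pr y) y] at h2
      rw [dist_comm z y] at h1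
      linarith
  have hφyz : φ z - φ y ≤ (C + 4) / c := by
    rw [le_div_iff₀ hc]
    have := hφ z y
    rw [abs_of_pos (by linarith), dist_comm] at this
    linarith
  have hoy : dist o (pr y) ≤ Δ * ((C + 4) / c) := by
    refine (ho y).trans (mul_le_mul_of_nonneg_left ?_ hΔ)
    rw [abs_of_nonneg (by linarith)]
    linarith
  have hoz : dist o (pr z) ≤ Δ * ((C + 4) / c) := by
    refine (ho z).trans (mul_le_mul_of_nonneg_left ?_ hΔ)
    rw [abs_of_neg (by linarith)]
    linarith
  have hnear : ∀ {w z : X}, dist o (pr z) ≤ Δ * ((C + 4) / c) → dist w (pr w) ≤ 2 * C + 1 →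
      dist (pr w) (pr z) ≤ 6 * C + 2 → dist w o ≤ 8 * C + 3 + Δ * ((C + 4) / c) := by
    intro w z h1 h2 h3
    have := dist_triangle4 w (pr w) (pr z) o
    rw [dist_comm (pr z) o] at this
    linarith
  rcases hA.dist_le_or_exists_near hpr hC u y with h | ⟨w, hw, hwA, hwy⟩
  · rcases hA.dist_le_or_exists_near hpr hC v z with h' | ⟨w, hw, hwA, hwz⟩
    · exfalso
      have h1 := hφ u v
      have h2 := dist_triangle4 (pr u) (pr y) (pr z) (pr v)
      rw [dist_comm (pr z)] at h2
      have h3 : (13 * C + 8) / c < |φ u - φ v| := by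
        rw [abs_sub_comm]
        exact lt_of_lt_of_le (by linarith) (le_abs_self _)
      rw [div_lt_iff₀ hc] at h3
      linarith
    · refine ⟨w, ?_, hnear hoz hwA hwz⟩
      have h1 := dist_triangle u w v
      have h2 := dist_triangle u z w
      rw [dist_comm v w, dist_comm w z, dist_comm v z] at hw
      linarith
  · refine ⟨w, ?_, hnear hoy hwA hwy⟩
    have h1 := dist_triangle u w v
    have h2 := dist_triangle w y v
    linarith

end Contracting

section

/-! ### Contracting isometries have contracting segments -/

/-- Orbits are locally finite since the translation length is positive, so closest points exist. -/
theorem exists_closest_on_orbit [Nonempty X] {g : X ≃ᵢ X} {τ : ℝ≥0}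
    (hτ : HasTranslationLength edist g τ) (hpos : 0 < τ) (x p : X) :
    ∃ i : ℤ, ∀ j : ℤ, dist p ((g ^ i) x) ≤ dist p ((g ^ j) x) := by
  set B : ℤ := ⌈2 * dist p x / τ⌉ with hB
  have hB0 : 0 ≤ B := Int.ceil_nonneg (by positivity)
  obtain ⟨i, -, hi⟩ := Set.exists_min_image (Set.Icc (-B) B) (fun i : ℤ => dist p ((g ^ i) x))
    (Set.finite_Icc _ _) ⟨0, by omega, hB0⟩
  refine ⟨i, fun j => ?_⟩
  by_cases hj : j ∈ Set.Icc (-B) B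
  · exact hi j hj
  · have h0 := hi 0 ⟨by omega, hB0⟩
    rw [zpow_zero] at h0
    have h1 := mul_abs_sub_le_dist hτ x 0 j
    rw [zpow_zero] at h1
    have hlt : B < |j| := by
      by_contra! hc
      exact hj (abs_le.1 hc)
    have h2 : 2 * dist p x ≤ τ * |(j : ℝ)| := by
      have h3 : (B : ℝ) ≤ |(j : ℝ)| := by exact_mod_cast hlt.le
      have h4 := Int.le_ceil (2 * dist p x / (τ : ℝ))
      have hτ0 : (0 : ℝ) < τ := by exact_mod_cast hpos
      rw [div_le_iff₀ hτ0] at h4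
      have := mul_le_mul_of_nonneg_left h3 hτ0.le
      linarith
    have h5 := dist_triangle_left ((1 : X ≃ᵢ X) x) ((g ^ j) x) p
    change dist p x ≥ _ at h0
    change _ ≤ dist p x + _ at h5
    simp only [Int.cast_zero, zero_sub, abs_neg] at h1
    linarith

variable [CAT0Space X]

/-- A contracting orbit is a bottleneck system: the side of a point is read off from its closest
point on the orbit. -/
theorem exists_bottleneckSystem_of_isContractingSet [Nonempty X] {g : X ≃ᵢ X} {τ : ℝ≥0}
    (hτ : HasTranslationLength edist g τ) (hpos : 0 < τ) {x : X} {C : ℝ}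
    (hC : IsContractingSet C (Set.range fun n : ℤ => (g ^ n) x)) :
    ∃ (N P : ℤ → Set X) (K : ℕ) (R : ℝ),
      BottleneckSystem (fun n : ℤ => (g ^ n) x) N P K R τ (dist x (g x)) := by
  have hτ0 : (0 : ℝ) < τ := by exact_mod_cast hpos
  choose idx hidx using exists_closest_on_orbit hτ hpos x
  have hC' : IsContractingSet (max C 1) (Set.range fun n : ℤ => (g ^ n) x) :=
    fun o r hd p hp q hq a ha b hb => (hC o r hd p hp q hq a ha b hb).trans (le_max_left _ _)
  obtain ⟨T, R, hT, hR, hpass⟩ := exists_pass (X := X) (le_max_right C 1) hτ0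
    (dist_nonneg (x := x) (y := g x))
  have hself : ∀ i : ℤ, idx ((g ^ i) x) = i := fun i => by
    have h1 := hidx ((g ^ i) x) i
    rw [dist_self] at h1
    have h2 := (mul_abs_sub_le_dist hτ x i (idx ((g ^ i) x))).trans h1
    have h3 : |(i : ℝ) - idx ((g ^ i) x)| ≤ 0 := by
      by_contra! hc
      have := mul_pos hτ0 hc
      linarith
    have h4 := sub_eq_zero.1 (abs_nonpos_iff.1 h3)
    exact_mod_cast h4.symm
  refine ⟨fun k => {p | idx p ≤ k}, fun k => {p | k + 1 ≤ idx p}, ⌈T⌉₊, R, ?_⟩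
  exact
    { nonneg := hR
      pos := hτ0
      monotone := fun k l hkl p hp => le_trans hp hkl
      antitone := fun k l hkl p hp => le_trans (by omega : k + 1 ≤ l + 1) hp
      mem_left := fun {i k} hik => show idx _ ≤ k by rw [hself]; exact hik
      mem_right := fun {i k} hik => show k + 1 ≤ idx _ by rw [hself]; exact hik
      left_of_not_right := fun {p k} hp => show idx p ≤ k + 1 from
        (not_le.1 (show ¬ k + 1 ≤ idx p from hp)).le
      right_of_not_left := fun {p k} hp => show k - 1 + 1 ≤ idx p by
        have : k < idx p := not_le.1 hp
        omega
      pass := fun {u v k} hu hv => hpass _ (fun p => (g ^ idx p) x) (fun p => idx p) hC'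
        (fun p => ⟨⟨_, rfl⟩, by rintro _ ⟨j, rfl⟩; exact hidx p j⟩)
        (fun p q => mul_abs_sub_le_dist hτ x _ _) _ k
        (fun p => dist_le_mul_abs_sub g x _ _) u v (by exact_mod_cast hu) (by
          have h1 : ((k : ℝ) + ⌈T⌉₊ + 1) ≤ idx v := by exact_mod_cast hv
          have := Nat.le_ceil T
          linarith)
      lower := fun i j => mul_abs_sub_le_dist hτ x i j
      upper := fun i j => dist_le_mul_abs_sub g x i j }

/-- The segments between points of a bottleneck system are uniformly contracting, because they are
uniformly close to the intervals of the system that they span. -/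
theorem BottleneckSystem.exists_isContractingSet_segment {x : ℤ → X} {N P : ℤ → Set X} {K : ℕ}
    {R c Δ : ℝ} (S : BottleneckSystem x N P K R c Δ) :
    ∃ C : ℝ, ∀ n : ℕ, IsContractingSet C (segment (x 0) (x n)) := by
  have hR := S.nonneg
  have hΔ : 0 ≤ Δ := by
    have := dist_nonneg.trans (S.upper 0 1)
    simpa using this
  set R' := R + Δ * K with hR'
  have hR'0 : 0 ≤ R' := by positivity
  obtain ⟨C, hC⟩ := S.exists_isContractingSet (δ := 3 * R' + Δ) (by positivity)
  refine ⟨C, fun n => hC _ (Set.Icc 0 (n : ℤ)) Set.ordConnected_Icc ?_ ?_⟩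
  all_goals
    -- A point `y` of the segment near `x k`, chosen to be the endpoint for `k = 0` and `k = n`.
    have hy : ∀ k : ℕ, ∃ y, k ≤ n → dist (x 0) y + dist y (x n) = dist (x 0) (x n) ∧
        dist y (x k) ≤ R' ∧ (k = 0 → y = x 0) ∧ (k = n → y = x n) := by
      intro k
      rcases Nat.eq_zero_or_pos k with rfl | hk0
      · exact ⟨x 0, fun _ => ⟨by simp, by simpa using hR'0, fun _ => rfl, fun h => by
          rw [← h]; rfl⟩⟩
      by_cases hkn : k + K < n
      · obtain ⟨y, hy, hyR⟩ := S.pass (k := k) (S.mem_left (i := 0) (by omega))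
          (S.mem_right (i := n) (by omega))
        have : 0 ≤ Δ * K := by positivity
        exact ⟨y, fun _ => ⟨hy, by linarith, fun h => by omega, fun h => by omega⟩⟩
      · refine ⟨x n, fun hk => ⟨by simp, ?_, fun h => by omega, fun _ => rfl⟩⟩
        have h1 := S.upper n k
        have h2 : |((n : ℤ) : ℝ) - ((k : ℤ) : ℝ)| ≤ K := by
          have : |(n : ℤ) - (k : ℤ)| ≤ K := by rw [abs_le]; constructor <;> omega
          exact_mod_cast this
        have h3 := mul_le_mul_of_nonneg_left h2 hΔ
        linarith
    choose y hy using hy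
  · intro a ha
    obtain ⟨γ, hγ, h₀, h₁⟩ := CAT0Space.exists_geodesic (x 0) (x n)
    rw [mem_segment_iff] at ha
    have haγ := hγ.eq_of_between h₀ h₁ ha
    have hmem : ∀ {p : X}, dist (x 0) p + dist p (x n) = dist (x 0) (x n) →
        dist (x 0) p ∈ Set.Icc 0 (dist (x 0) (x n)) := fun {p} hp =>
      ⟨dist_nonneg, by have := dist_nonneg (x := p) (y := x n); linarith⟩
    have hdist : ∀ {p q : X}, dist (x 0) p + dist p (x n) = dist (x 0) (x n) →
        dist (x 0) q + dist q (x n) = dist (x 0) (x n) →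
        dist p q = |dist (x 0) p - dist (x 0) q| := by
      intro p q hp hq
      conv_lhs => rw [← hγ.eq_of_between h₀ h₁ hp, ← hγ.eq_of_between h₀ h₁ hq]
      exact hγ _ (hmem hp) _ (hmem hq)
    -- `a` lies between two successive `y k`, `y (k + 1)`, or it is the endpoint `x n`.
    by_cases hex : ∃ k < n, dist (x 0) (y k) ≤ dist (x 0) a ∧ dist (x 0) a ≤ dist (x 0) (y (k + 1))
    · obtain ⟨k, hk, hk1, hk2⟩ := hex
      obtain ⟨e1, e2, -⟩ := hy k hk.le
      obtain ⟨f1, f2, -⟩ := hy (k + 1) hk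
      refine ⟨k, ⟨by omega, by omega⟩, ?_⟩
      have h1 := hdist ha e1
      have h2 := hdist f1 e1
      rw [abs_of_nonneg (by linarith)] at h1 h2
      have h3 := S.upper (k + 1 : ℕ) k
      have h4 := dist_triangle4 (y (k + 1)) (x (k + 1 : ℕ)) (x k) (y k)
      have h5 := dist_triangle a (y k) (x k)
      rw [dist_comm (x k)] at h4
      have h6 : |(((k + 1 : ℕ) : ℤ) : ℝ) - ((k : ℤ) : ℝ)| = 1 := by push_cast; simp
      rw [h6] at h3
      linarith
    · push Not at hex
      have hall : ∀ k ≤ n, dist (x 0) (y k) ≤ dist (x 0) a := by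
        intro k
        induction k with
        | zero => intro hk; rw [(hy 0 hk).2.2.1 rfl, dist_self]; exact dist_nonneg
        | succ k ih => exact fun hk => (hex k hk (ih (by omega))).le
      have hn := hall n le_rfl
      rw [(hy n le_rfl).2.2.2 rfl] at hn
      have hz : dist a (x n) = 0 := by
        have := dist_nonneg (x := a) (y := x n)
        linarith
      exact ⟨n, ⟨by omega, le_rfl⟩, by rw [hz]; positivity⟩
  · rintro k ⟨hk0, hkn⟩
    lift k to ℕ using hk0
    obtain ⟨e1, e2, -⟩ := hy k (by exact_mod_cast hkn)
    exact ⟨y k, mem_segment_iff.2 e1, by linarith⟩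

/-! ### Contracting segments are crossed by long chains of separated curtains -/

/-- Curtains dual to a contracting geodesic are `L`-separated as soon as they are far apart: every
curtain that meets both of them passes through a ball of controlled radius. -/
theorem exists_lSeparated_dualCurtain {C : ℝ} (hC : 1 ≤ C) :
    ∃ (W : ℝ) (L : ℕ+), 1 < W ∧ ∀ (γ : ℝ → X) (l : ℝ) (hγ : IsGeodesicOn γ (Set.Icc 0 l)),
      IsContractingSet C (γ '' Set.Icc 0 l) → ∀ (r r' : ℝ) (h₀ : 1 / 2 < r) (h₁ : r + 1 / 2 < l)
      (h₀' : 1 / 2 < r') (h₁' : r' + 1 / 2 < l), r + W ≤ r' →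
      LSeparated L (dualCurtain hγ r h₀ h₁) (dualCurtain hγ r' h₀' h₁') := by
  obtain ⟨T, R, hT, hR, hpass⟩ := exists_pass (X := X) hC one_pos zero_le_one
  have hLpos : 0 < ⌈2 * (R + T + 1) + 2⌉₊ := Nat.ceil_pos.2 (by positivity)
  refine ⟨2 * T + 3, ⟨⌈2 * (R + T + 1) + 2⌉₊, hLpos⟩, by linarith,
    fun γ l hγ hA r r' h₀ h₁ h₀' h₁' hr => ⟨(dualCurtain_below hγ h₀ h₁ h₀' h₁' (by
      linarith)).disjoint, fun n c hc hm => ?_⟩⟩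
  have hl : 0 ≤ l := by linarith
  choose φ hφ using fun p => hγ.exists_isFoot isClosed_Icc ⟨0, le_rfl, hl⟩ p
  have hpr : ∀ p, γ (φ p) ∈ closestPoints (γ '' Set.Icc 0 l) p := fun p =>
    ⟨⟨_, (hφ p).1, rfl⟩, by rintro _ ⟨t, ht, rfl⟩; exact (hφ p).2 t ht⟩
  have hpass' : ∀ s ∈ Set.Icc 0 l, ∀ u v, φ u ≤ s → s + T ≤ φ v →
      ∃ y, dist u y + dist y v = dist u v ∧ dist y (γ s) ≤ R := fun s hs =>
    hpass _ (fun p => γ (φ p)) φ hA hpr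
      (fun p q => by rw [one_mul, hγ _ (hφ p).1 _ (hφ q).1]) (γ s) s
      fun p => by rw [one_mul, hγ _ hs _ (hφ p).1]
  have hball : ∀ i, ∃ y ∈ (c i).carrier, dist y (γ (r + 1 / 2)) ≤ R + T + 1 := by
    intro i
    obtain ⟨⟨p, hp, hp'⟩, ⟨q, hq, hq'⟩⟩ := hm i
    have hφp : φ p ≤ r + 1 / 2 := by
      have := ((dualCurtain hγ r h₀ h₁).mem_carrier.1 hp').2
      rwa [dualCurtain_proj_eq hγ h₀ h₁ (hφ p)] at this
    have hφq : r' - 1 / 2 ≤ φ q := by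
      have := ((dualCurtain hγ r' h₀' h₁').mem_carrier.1 hq').1
      rwa [dualCurtain_proj_eq hγ h₀' h₁' (hφ q)] at this
    -- The geodesics from `p` and `q` to their feet on the pole are contained in the curtain.
    have hstar : ∀ {p y : X}, p ∈ (c i).carrier →
        dist p y + dist y ((c i).α ((c i).proj p)) = dist p ((c i).α ((c i).proj p)) →
        y ∈ (c i).carrier := by
      intro p y hp hy
      rw [Curtain.mem_carrier, (c i).proj_eq_of_between hy, ← Curtain.mem_carrier]
      exact hp
    have hpole : |φ ((c i).α ((c i).proj p)) - φ ((c i).α ((c i).proj q))| ≤ 1 := by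
      refine ((hφ _).dist_le hγ (hφ _)).trans ?_
      rw [(c i).isGeodesicOn _ ((c i).isFoot_proj p).1 _ ((c i).isFoot_proj q).1, abs_le]
      rw [Curtain.mem_carrier] at hp hq
      constructor <;> linarith [hp.1, hp.2, hq.1, hq.2]
    have hs : r + 1 / 2 ∈ Set.Icc 0 l := ⟨by linarith, h₁.le⟩
    by_cases hcase : r + 1 / 2 + T ≤ φ ((c i).α ((c i).proj p))
    · obtain ⟨y, hy, hyR⟩ := hpass' _ hs _ _ hφp hcase
      exact ⟨y, hstar hp hy, by linarith⟩
    · push Not at hcase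
      have hs' : r + 1 / 2 + T + 1 ∈ Set.Icc 0 l := ⟨by linarith, by linarith⟩
      obtain ⟨y, hy, hyR⟩ := hpass' _ hs' ((c i).α ((c i).proj q)) q
        (by linarith [(abs_le.1 hpole).1]) (by linarith)
      refine ⟨y, hstar hq ?_, ?_⟩
      · linarith [dist_comm q y, dist_comm y ((c i).α ((c i).proj q)),
          dist_comm q ((c i).α ((c i).proj q))]
      · have h1 := dist_triangle y (γ (r + 1 / 2 + T + 1)) (γ (r + 1 / 2))
        rw [hγ _ hs' _ hs, show r + 1 / 2 + T + 1 - (r + 1 / 2) = T + 1 by ring,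
          abs_of_pos (by linarith)] at h1
        linarith
  have h1 := hc.card_le_of_dist_le (by positivity) hball
  have h2 := h1.trans (Nat.le_ceil _)
  exact_mod_cast h2

/-- If the segments `[x, g ^ n x]` are uniformly contracting, then curtains dual to them at uniform
spacing form `L`-chains whose length grows linearly with `n`. -/
theorem exists_isLoxodromic_of_isContractingSet_segment [Nonempty X] {g : X ≃ᵢ X} {τ : ℝ≥0}
    (hτ : HasTranslationLength edist g τ) (hpos : 0 < τ) {x : X} {C : ℝ}
    (hC : ∀ n : ℕ, IsContractingSet C (segment x ((g ^ n) x))) :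
    ∃ L : ℕ+, IsLoxodromic (distL (X := X) (L : ℕ)) g := by
  have hτ0 : (0 : ℝ) < τ := by exact_mod_cast hpos
  obtain ⟨W, L, hW, hsep⟩ := exists_lSeparated_dualCurtain (X := X) (le_max_right C 1)
  have hW0 : 0 < W := by linarith
  refine ⟨L, ?_⟩
  obtain ⟨t, ht, -⟩ := exists_hasTranslationLength_distL (X := X) (L : ℕ) g
  refine ⟨t, ?_, ht⟩
  have hlow : ∀ n : ℕ, τ * n ≤ W * ((distL (L : ℕ) x ((g ^ n) x)).toReal + 1) + 2 := by
    intro n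
    obtain ⟨γ, hγ, h₀, h₁⟩ := CAT0Space.exists_geodesic x ((g ^ n) x)
    have hcon : IsContractingSet (max C 1) (γ '' Set.Icc 0 (dist x ((g ^ n) x))) := by
      rw [← segment_eq_image hγ h₀ h₁]
      exact fun o r hd p hp q hq a ha b hb =>
        (hC n o r hd p hp q hq a ha b hb).trans (le_max_left _ _)
    have hτn := mul_abs_sub_le_dist hτ x 0 n
    rw [zpow_zero, zpow_natCast] at hτn
    simp only [Int.cast_zero, Int.cast_natCast, zero_sub, abs_neg, Nat.abs_cast] at hτn
    change _ ≤ dist x _ at hτn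
    set l := dist x ((g ^ n) x)
    have hl0 : 0 ≤ l := dist_nonneg
    set m := ⌊(l - 2) / W⌋₊ with hm
    have hr₀ : ∀ i : Fin m, 1 / 2 < 1 + ((i : ℕ) : ℝ) * W := fun i => by
      have : 0 ≤ ((i : ℕ) : ℝ) * W := by positivity
      linarith
    have hr₁ : ∀ i : Fin m, 1 + ((i : ℕ) : ℝ) * W + 1 / 2 < l := fun i => by
      have h1 : ((i : ℕ) : ℝ) + 1 ≤ m := by exact_mod_cast i.2
      have hl2 : 0 ≤ (l - 2) / W := by
        by_contra! hneg
        have : m = 0 := Nat.floor_of_nonpos hneg.le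
        exact absurd i.2 (by omega)
      have h2 := Nat.floor_le hl2
      rw [← hm, le_div_iff₀ hW0] at h2
      nlinarith
    have hlt : ∀ i j : Fin m, i < j → 1 + ((i : ℕ) : ℝ) * W + W ≤ 1 + ((j : ℕ) : ℝ) * W := by
      intro i j hij
      have : ((i : ℕ) : ℝ) + 1 ≤ (j : ℕ) := by exact_mod_cast Fin.lt_def.1 hij
      nlinarith
    have hchain : ExistsLChain L x ((g ^ n) x) m := by
      refine ⟨fun i => dualCurtain hγ _ (hr₀ i) (hr₁ i), ⟨isChain_of_below fun i j hij =>
        dualCurtain_below hγ _ _ _ _ (by linarith [hlt i j hij]), fun i j hij => ?_⟩,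
        fun i => Or.inl ?_⟩
      · rcases lt_or_gt_of_ne hij with h | h
        · exact hsep γ l hγ hcon _ _ _ _ _ _ (hlt i j h)
        · exact (hsep γ l hγ hcon _ _ _ _ _ _ (hlt j i h)).symm
      · have hx : IsFoot γ (Set.Icc 0 l) x 0 := by
          have := isFoot_self (α := γ) (I := Set.Icc 0 l) (t := 0) ⟨le_rfl, hl0⟩
          rwa [h₀] at this
        have hy : IsFoot γ (Set.Icc 0 l) ((g ^ n) x) l := by
          have := isFoot_self (α := γ) (I := Set.Icc 0 l) (t := l) ⟨hl0, le_rfl⟩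
          rwa [h₁] at this
        rw [Set.singleton_subset_iff, Set.singleton_subset_iff, Curtain.mem_neg, Curtain.mem_pos,
          dualCurtain_proj_eq hγ _ _ hx, dualCurtain_proj_eq hγ _ _ hy]
        exact ⟨sub_pos.2 (hr₀ i), hr₁ i⟩
    have hmd : (m : ℝ) ≤ (distL (L : ℕ) x ((g ^ n) x)).toReal := by
      have := ENNReal.toReal_mono (distL_ne_top _ _ _) (natCast_le_distL hchain)
      simpa using this
    have h1 := (Nat.lt_floor_add_one ((l - 2) / W)).le
    rw [← hm, div_le_iff₀ hW0] at h1
    nlinarith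
  have hlim : Tendsto (fun n : ℕ => W * ((distL (L : ℕ) x ((g ^ n) x)).toReal / n) + (W + 2) / n)
      atTop (𝓝 (W * t + 0)) :=
    ((ht.tendsto_toReal x).const_mul W).add
      (tendsto_const_nhds.div_atTop tendsto_natCast_atTop_atTop)
  have hge : (τ : ℝ) ≤ W * t + 0 := by
    refine ge_of_tendsto hlim ?_
    filter_upwards [eventually_gt_atTop 0] with n hn
    have hn' : (0 : ℝ) < n := by exact_mod_cast hn
    rw [← mul_div_assoc, ← add_div, le_div_iff₀ hn']
    linarith [hlow n]
  have : 0 < W * (t : ℝ) := by linarith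
  exact_mod_cast pos_of_mul_pos_right this hW0.le

end

section

variable [CAT0Space X]

/-! ### Loxodromic isometries of `X_L` are contracting -/

/-- If `g` is loxodromic on `X_L`, then `L`-chains with any number `m` of members separate
`x, g ^ n x` from `g ^ (2 * n) x, g ^ (3 * n) x` for some `n`: the maximal `L`-chains separating
`x` from `g ^ (3 * n) x` have length about `3 * t * n`, and at most about `2 * t * n` of their
members do not separate the two points in the middle. -/
theorem IsLoxodromic.exists_sorted [Nonempty X] {L : ℕ} {g : X ≃ᵢ X}
    (hg : IsLoxodromic (distL (X := X) L) g) (x : X) (m : ℕ) :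
    ∃ n : ℕ, 0 < n ∧ ∃ E : Fin m → Curtain X, (∀ i j, i < j → (E i).Below (E j)) ∧
      (∀ i j, i ≠ j → LSeparated L (E i) (E j)) ∧ ∀ i, x ∈ (E i).neg ∧ (g ^ n) x ∈ (E i).neg ∧
        (g ^ n) ((g ^ n) x) ∈ (E i).pos ∧ (g ^ n) ((g ^ n) ((g ^ n) x)) ∈ (E i).pos := by
  obtain ⟨t, ht0, ht⟩ := hg
  obtain ⟨t', ht', hle⟩ := exists_hasTranslationLength_distL (X := X) L g
  obtain rfl := ht.unique ht'
  have ht0 : (0 : ℝ) < t := by exact_mod_cast ht0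
  obtain ⟨n, hn, hn1, hn2⟩ : ∃ n : ℕ, 0 < n ∧
      (distL L x ((g ^ n) x)).toReal ≤ 5 / 4 * t * n ∧ 2 * (m + 4) / t ≤ (n : ℝ) := by
    have h1 : ∀ᶠ n : ℕ in atTop, (distL L x ((g ^ n) x)).toReal / n < 5 / 4 * t :=
      (ht.tendsto_toReal x).eventually_lt_const (by linarith)
    obtain ⟨n, h1, h2, h3⟩ := (h1.and ((eventually_gt_atTop 0).and
      (tendsto_natCast_atTop_atTop.eventually_ge_atTop (2 * (m + 4) / (t : ℝ))))).exists
    rw [div_lt_iff₀ (by exact_mod_cast h2)] at h1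
    exact ⟨n, h2, h1.le, h3⟩
  refine ⟨n, hn, ?_⟩
  rw [div_le_iff₀ ht0] at hn2
  set G := g ^ n
  have h3n := hle x (n + (n + n))
  rw [pow_add_apply, pow_add_apply] at h3n
  have hn0 : (0 : ℝ) < n := by exact_mod_cast hn
  have hne : x ≠ G (G (G x)) := by
    intro h
    change _ ≤ (distL L x (G (G (G x)))).toReal at h3n
    rw [← h, distL_self, ENNReal.toReal_zero] at h3n
    push_cast at h3n
    have := mul_pos ht0 hn0
    linarith
  obtain ⟨M, ⟨c, hc, hs⟩, hM, -⟩ := exists_distL_eq L hne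
  have hdisj : ∀ s : Finset (Fin M), ∀ i ∈ s, ∀ j ∈ s, i ≠ j →
      Disjoint (c i).carrier (c j).carrier := fun s i _ j _ hij => hc.1.1 i j hij
  have hcard : ∀ (s : Finset (Fin M)) (p q : X), distL L p q = distL L x (G x) →
      (∀ i ∈ s, (c i).Separates {p} {q}) → (s.card : ℝ) ≤ 5 / 4 * t * n := by
    intro s p q hpq hsep
    have := ENNReal.toReal_mono (distL_ne_top L p q)
      (natCast_le_distL (existsLChain_card s c (fun i _ j _ hij => hc.2 i j hij) hsep))
    rw [ENNReal.toReal_natCast, hpq] at this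
    exact this.trans hn1
  obtain ⟨a, -, b, -, hab, ha, hb⟩ := card_le_card_add_card Finset.univ c (hdisj _)
    (fun i _ => hs i) (G x)
  obtain ⟨e, he, f, -, hef, hesep, hf⟩ := card_le_card_add_card b c (hdisj _) hb (G (G x))
  have hacard := hcard a x (G x) rfl ha
  have hfcard := hcard f (G (G x)) (G (G (G x))) (by rw [distL_map, distL_map]) hf
  rw [Finset.card_univ, Fintype.card_fin] at hab
  have hme : m ≤ e.card := by
    change _ ≤ (distL L x (G (G (G x)))).toReal at h3n
    rw [hM, ENNReal.toReal_add ENNReal.one_ne_top (ENNReal.natCast_ne_top M), ENNReal.toReal_one,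
      ENNReal.toReal_natCast] at h3n
    push_cast at h3n
    have h1 : (M : ℝ) ≤ a.card + b.card + 1 := by exact_mod_cast hab
    have h2 : (b.card : ℝ) ≤ e.card + f.card + 1 := by exact_mod_cast hef
    have h3 : (m : ℝ) ≤ e.card := by linarith
    exact_mod_cast h3
  obtain ⟨o, c', ho, h₁, h₂⟩ := CurtainModel.exists_sorted e c (hdisj _) hesep
  refine ⟨fun i => c' (Fin.castLE hme i), fun i j hij => h₂ _ _ (by simpa using hij),
    fun i j hij => ?_, fun i => ?_⟩
  · exact (hc.2 _ _ (ho.ne ((Fin.castLE_injective hme).ne hij))).congr (h₁ _).2.1.1 (h₁ _).2.1.1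
  · obtain ⟨hmem, ⟨-, hsep⟩, h1, h2⟩ := h₁ (Fin.castLE hme i)
    set k := c' (Fin.castLE hme i)
    have hdj := Set.disjoint_left.1 k.disjoint_neg_pos
    have h3 : G (G (G x)) ∈ k.pos := by
      rcases hsep _ _ (hb _ (he hmem)) with h | h
      · exact Set.singleton_subset_iff.1 h.2
      · exact absurd (Set.singleton_subset_iff.1 h.2) (hdj h1)
    refine ⟨?_, h1, h2, h3⟩
    rcases hsep _ _ (hs _) with h | h
    · exact Set.singleton_subset_iff.1 h.1
    · exact absurd h3 (hdj (Set.singleton_subset_iff.1 h.1))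

/-- An isometry that is loxodromic on `X_L` has a power `G` that moves some curtain `h` to an
`L`-separated curtain above it. Among long `L`-chains `E` there are members `h = E j` such that
`G h` misses a later member `e = E i`, because `E (L + 1)` and `E (L + 2)` are `L`-separated;
and `e` lies between `h` and `G h`. -/
theorem IsLoxodromic.exists_below_map [Nonempty X] {L : ℕ} {g : X ≃ᵢ X}
    (hg : IsLoxodromic (distL (X := X) L) g) :
    ∃ (n : ℕ) (h : Curtain X) (x : X), 0 < n ∧ h.Below (h.map (g ^ n)) ∧
      LSeparated L h (h.map (g ^ n)) ∧ x ∈ h.neg ∧ (g ^ n) x ∈ h.pos := by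
  obtain ⟨x⟩ := ‹Nonempty X›
  have : Nonempty X := ⟨x⟩
  obtain ⟨n, hn, E, hE, hsep, hx⟩ := hg.exists_sorted x (L + 3)
  set G := g ^ n
  have hmap : ∀ (h : Curtain X) (p : X), (p ∈ h.neg → G p ∈ (h.map G).neg) ∧
      (p ∈ h.pos → G p ∈ (h.map G).pos) := fun h p => by
    rw [Curtain.map_neg, Curtain.map_pos]
    exact ⟨Set.mem_image_of_mem _, Set.mem_image_of_mem _⟩
  have hbelow : ∀ i j, Disjoint (E i).carrier ((E j).map G).carrier →
      (E i).Below ((E j).map G) := by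
    intro i j hd
    refine (Curtain.below_or_below hd (hx i).2.1 ((hmap _ _).1 (hx j).1) (hx i).2.2.2
      ((hmap _ _).2 (hx j).2.2.1)).resolve_right fun hb => ?_
    exact Set.disjoint_left.1 (Curtain.disjoint_neg_pos _) ((hmap _ _).1 (hx j).2.1)
      (hb.pos_subset (hx i).2.2.1)
  obtain ⟨i, j, hji, hd⟩ : ∃ i j, j < i ∧ Disjoint (E i).carrier ((E j).map G).carrier := by
    by_contra! hc
    replace hc : ∀ i j, j < i → (((E j).map G).carrier ∩ (E i).carrier).Nonempty := fun i j hji => by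
      rw [Set.inter_comm, ← Set.not_disjoint_iff_nonempty_inter]
      exact hc i j hji
    set i₁ : Fin (L + 3) := ⟨L + 1, by omega⟩
    set i₂ : Fin (L + 3) := ⟨L + 2, by omega⟩
    have hle : L + 1 ≤ L + 3 := by omega
    have hlt : ∀ k : Fin (L + 1), Fin.castLE hle k < i₁ ∧ Fin.castLE hle k < i₂ := fun k => by
      have := k.2
      constructor <;> rw [Fin.lt_def] <;> simp only [Fin.val_castLE, i₁, i₂] <;> omega
    have hne : i₁ ≠ i₂ := by simp [i₁, i₂]
    have := (hsep i₁ i₂ hne).2 (L + 1) (fun k => (E (Fin.castLE hle k)).map G)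
      (IsChain.map (isChain_of_below fun k l hkl => hE _ _ (by simpa using hkl)) G)
      fun k => ⟨hc _ _ (hlt k).1, hc _ _ (hlt k).2⟩
    omega
  exact ⟨n, E j, G x, hn, (hE j i hji).trans (hbelow i j hd),
    (hsep j i hji.ne).of_below_right (hE j i hji) (hbelow i j hd), (hx j).2.1, (hx j).2.2.1⟩

/-- The translates by the powers of `G` of a curtain `h` as in `IsLoxodromic.exists_below_map`
are the sides of a bottleneck system. -/
theorem IsLoxodromic.exists_bottleneckSystem [Nonempty X] {L : ℕ} {g : X ≃ᵢ X}
    (hg : IsLoxodromic (distL (X := X) L) g) {τ : ℝ≥0}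
    (hτ : HasTranslationLength edist g τ) (hpos : 0 < τ) :
    ∃ (x : X) (n : ℕ) (N P : ℤ → Set X) (K : ℕ) (R c Δ : ℝ), 0 < n ∧
      BottleneckSystem (fun k : ℤ => (g ^ (n * k : ℤ)) x) N P K R c Δ := by
  obtain ⟨n, h, x, hn, hb, hsep, hx, hGx⟩ := hg.exists_below_map
  set G := g ^ n with hG
  have hGz : ∀ k : ℤ, g ^ (n * k : ℤ) = G ^ k := fun k => by rw [zpow_mul, zpow_natCast]
  set H : ℤ → Curtain X := fun k => h.map (G ^ k) with hH
  have hHsucc : ∀ k, H (k + 1) = (h.map G).map (G ^ k) := fun k => by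
    rw [Curtain.map_map, ← zpow_add_one]
  have hHb : ∀ k, (H k).Below (H (k + 1)) := fun k => by rw [hHsucc]; exact hb.map _
  have hHs : ∀ k, LSeparated L (H k) (H (k + 1)) := fun k => by rw [hHsucc]; exact hsep.map _
  have hmono : Monotone fun k => (H k).neg := monotone_int_of_le_succ fun k => (hHb k).neg_subset
  have hanti : Antitone fun k => (H k).pos := antitone_int_of_succ_le fun k => (hHb k).pos_subset
  have hneg : ∀ {i k : ℤ}, i ≤ k → (G ^ i) x ∈ (H k).neg := fun {i k} hik => by
    apply hmono hik
    simp only [H, Curtain.map_neg]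
    exact Set.mem_image_of_mem _ hx
  have hpos' : ∀ {i k : ℤ}, k < i → (G ^ i) x ∈ (H k).pos := fun {i k} hik => by
    apply hanti (show k ≤ i - 1 by omega)
    have : (G ^ i) x = (G ^ (i - 1)) (G x) := by
      rw [← zpow_one G, ← zpow_mul, ← zpow_mul, ← zpow_add_apply]
      ring_nf
    simp only [H, Curtain.map_pos]
    rw [this]
    exact Set.mem_image_of_mem _ hGx
  have hτ0 : (0 : ℝ) < τ := by exact_mod_cast hpos
  have hup : ∀ i j : ℤ, dist ((G ^ i) x) ((G ^ j) x) ≤ dist x (G x) * |(i : ℝ) - j| :=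
    fun i j => dist_le_mul_abs_sub G x i j
  refine ⟨x, n, fun k => (H k).neg, fun k => (H k).pos, 2, L + 1 + dist x (G x) * 3, τ * n,
    dist x (G x), hn, ?_⟩
  simp only [hGz]
  exact
    { nonneg := by positivity
      pos := by positivity
      monotone := hmono
      antitone := hanti
      mem_left := hneg
      mem_right := hpos'
      left_of_not_right := fun {p k} hp => hHb k (by
        by_cases hn : p ∈ (H k).neg
        · exact Or.inr hn
        · exact Or.inl ((H k).mem_carrier_of_not_mem hn hp))
      right_of_not_left := fun {p k} hp => by
        have := hHb (k - 1)
        rw [sub_add_cancel] at this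
        refine this.subset_pos ?_
        by_cases hpp : p ∈ (H k).pos
        · exact Or.inr hpp
        · exact Or.inl ((H k).mem_carrier_of_not_mem hp hpp)
      pass := fun {u v k} hu hv => by
        have h12 := hHb k
        have h23 := hHb (k + 1)
        have s12 := hHs k
        have s23 := hHs (k + 1)
        have h3 : k + 1 + 1 = k + 2 := by ring
        rw [h3] at h23 s23
        have hv : v ∈ (H (k + 2)).pos := hv
        obtain ⟨y, hy, hyb⟩ := (H (k + 1)).exists_between_mem_carrier (h12.neg_subset hu)
          (h23.pos_subset hv)
        obtain ⟨β, hβ, hβ₀, hβ₁⟩ := CAT0Space.exists_geodesic ((G ^ k) x) ((G ^ (k + 3)) x)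
        obtain ⟨s, hs, hys⟩ := exists_dist_le_of_lSeparated h12 h23 s12 s23 (hneg le_rfl) hu
          (hpos' (by omega)) hv hy hyb hβ hβ₀ hβ₁
        refine ⟨y, hyb, ?_⟩
        have h1 := dist_triangle y (β s) ((G ^ k) x)
        have h2 : dist (β s) ((G ^ k) x) = s := by
          rw [← hβ₀, hβ s hs 0 ⟨le_rfl, dist_nonneg⟩, sub_zero, abs_of_nonneg hs.1]
        have h4 := hup k (k + 3)
        have h5 : |(k : ℝ) - ((k + 3 : ℤ) : ℝ)| = 3 := by
          push_cast
          rw [sub_add_cancel_left, abs_neg]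
          norm_num
        rw [h5] at h4
        linarith [hs.2]
      lower := fun i j => by
        have := mul_abs_sub_le_dist hτ x (n * i) (n * j)
        push_cast at this
        rw [← mul_sub, abs_mul, Nat.abs_cast, ← mul_assoc, hGz, hGz] at this
        exact this
      upper := hup }

theorem IsLoxodromic.isContracting [Nonempty X] {L : ℕ} {g : X ≃ᵢ X}
    (hg : IsLoxodromic (distL (X := X) L) g) {τ : ℝ≥0}
    (hτ : HasTranslationLength edist g τ) (hpos : 0 < τ) : IsContracting g := by
  obtain ⟨x, n, N, P, K, R, c, Δ, hn, S⟩ := hg.exists_bottleneckSystem hτ hpos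
  have hδ : 0 ≤ dist x (g x) * n := by positivity
  obtain ⟨C, hC⟩ := S.exists_isContractingSet hδ
  refine ⟨x, isQIEmbedding_orbit hτ hpos x, C, hC _ Set.univ Set.ordConnected_univ ?_ ?_⟩
  · rintro _ ⟨m, rfl⟩
    refine ⟨m / n, trivial, (dist_le_mul_abs_sub g x _ _).trans ?_⟩
    have hn' : (0 : ℤ) < n := by exact_mod_cast hn
    have h1 : |m - n * (m / n)| ≤ (n : ℤ) := by
      have h2 := Int.emod_add_mul_ediv m n
      have h3 := Int.emod_nonneg m hn'.ne'
      have h4 := Int.emod_lt_of_pos m hn'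
      rw [abs_le]
      constructor <;> linarith
    gcongr
    exact_mod_cast h1
  · intro k _
    exact ⟨_, ⟨n * k, rfl⟩, by rw [dist_self]; exact hδ⟩

theorem IsContracting.exists_isContractingSet_segment [Nonempty X] {g : X ≃ᵢ X} {τ : ℝ≥0}
    (hg : IsContracting g) (hτ : HasTranslationLength edist g τ) (hpos : 0 < τ) :
    ∃ x : X, ∃ C : ℝ, ∀ n : ℕ, IsContractingSet C (segment x ((g ^ n) x)) := by
  obtain ⟨x, -, C, hC⟩ := hg
  obtain ⟨N, P, K, R, S⟩ := exists_bottleneckSystem_of_isContractingSet hτ hpos hC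
  exact ⟨x, S.exists_isContractingSet_segment⟩

end

end CurtainModel

end

theorem mainTheorem4 {X : Type*} [MetricSpace X] [CurtainModel.CAT0Space X] [Nonempty X]
    (lam : ℕ+ → ℝ) (hlam : CurtainModel.IsWeight lam)
    (g : X ≃ᵢ X) (hg : CurtainModel.IsParabolic g)
    (τ : ℝ≥0) (hτ : CurtainModel.HasTranslationLength edist g τ) (hpos : 0 < τ) :
    List.TFAE [
      CurtainModel.IsContracting g,
      ∃ x : X, ∃ C : ℝ, ∀ n : ℕ,
        CurtainModel.IsContractingSet C (CurtainModel.segment x ((g ^ n) x)),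
      ∃ L : ℕ+, CurtainModel.IsLoxodromic (CurtainModel.distL (L : ℕ)) g,
      CurtainModel.IsLoxodromic (CurtainModel.distD lam) g] := by
  tfae_have 1 → 2 := fun h => h.exists_isContractingSet_segment hτ hpos
  tfae_have 2 → 3 := fun ⟨_, _, h⟩ =>
    CurtainModel.exists_isLoxodromic_of_isContractingSet_segment hτ hpos h
  tfae_have 3 → 1 := fun ⟨_, h⟩ => h.isContracting hτ hpos
  tfae_have 4 ↔ 3 := CurtainModel.isLoxodromic_distD_iff hlam g
  tfae_finish
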